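/- **Setting.** Consider the mathematical program with disjunctive constraints $$\min_{x\in\mathbb R^n} f(x)\quad\text{s.t.}\quad F_i(x)\in D_i:=\bigcup_{j=1}^{K_i}D_i^j,\quad i=1,\dots,m_D,$$ where $f:\mathbb R^n\to\mathbb R$ and $F_i:\mathbb R^n\to\mathbb R^{l_i}$ are continuously differentiable and $D_i^j=\{y\mid\langle a^{i,j}_s,y\rangle\le b^{i,j}_s,\ s=1,\dots,p^{i,j}\}$ with $\|a^{i,j}_s\|=1$. Put $m=\sum_i l_i$, $F=(F_1,\dots,F_{m_D})$, $D=\prod_i D_i$ and $D(\nu)=\prod_iD_i^{\nu_i}$ for $\nu\in\prod_i\{1,\dots,K_i\}$. Distances to the empty set are $+\infty$, and $Q^\circ=\{q^*\mid\langle q^*,q\rangle\le0\ \forall q\in Q\}$. For a set $\Omega$, $T_\Omega$ denotes the contingent cone, $\widehat N_\Omega=(T_\Omega)^\circ$ (empty outside $\Omega$) the regular normal cone, and $N_\Omega(z)$ the limiting normal cone (limits of $w_k\in\widehat N_\Omega(z_k)$ with $z_k\to z$). A multifunction $\Psi$ is metrically regular near a point $(\bar x,\bar y)$ of its graph if for some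 $\kappa>0$ one has $\operatorname{dist}(x,\Psi^{-1}(y))\le\kappa\operatorname{dist}(y,\Psi(x))$ for all $(x,y)$ near $(\bar x,\bar y)$; it is metrically subregular at $(\bar x,\bar y)$ if this holds for $y=\bar y$ and all $x$ near $\bar x$. Let $\bar x$ be feasible. It is *B-stationary* if $\langle\nabla f(\bar x),u\rangle\ge0$ for all $u\in T_{F^{-1}(D)}(\bar x)$, and *M-stationary* if $-\nabla f(\bar x)\in\nabla F(\bar x)^TN_D(F(\bar x))$. Let $\mathcal A_i=\{j\mid F_i(\bar x)\in D_i^j\}$ and fix sets $\mathcal J_i\subset\mathcal A_i$ with $T_{D_i}(F_i(\bar x))=\bigcup_{j\in\mathcal J_i}T_{D_i^j}(F_i(\bar x))$. The point $\bar x$ is *$\mathcal Q_M$-stationary* if there are $K\ge1$ and $\nu^1,\dots,\nu^K$ with $\{\nu^1_i,\dots,\nu^K_i\}=\mathcal J_i$ for all $i$ such that, with $Q_l=T_{D(\nu^l)}(F(\bar x))$, $$-\nabla f(\bar x)\in\nabla F(\bar x)^T\Big(N_D(F(\bar x))\cap Q_1^\circ\cap\bigcap_{l=2}^K\big(\ker\nabla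 F(\bar x)^T+Q_l^\circ\big)\Big).$$ Let $\mathcal M(\bar x)$ (resp. $\mathcal M_{sub}(\bar x)$) be the set of $\nu\in\prod_i\mathcal J_i$ such that $F(\cdot)-D(\nu)$ is metrically regular near $(\bar x,0)$ (resp. metrically subregular at $(\bar x,0)$). **Basic algorithm** for $\min q(z)=\frac12z^TBz+d^Tz$ s.t. $Az\in\prod_i\bigcup_{j\in I_i}C_i^j$. Start at any feasible $z^1$. At the iterate $z^k$, choose sets $J_i\subset\{j\in I_i\mid (Az^k)_i\in C_i^j\}$ such that, at $(Az^k)_i$, the tangent cone to $\bigcup_{j\in I_i}C_i^j$ is the union of the tangent cones to $C_i^j$, $j\in J_i$; choose $K\ge1$ and $\nu^1,\dots,\nu^K$ with $\{\nu^1_i,\dots,\nu^K_i\}=J_i$ for all $i$. Consider the programs $\min q(z)$ s.t. $Az\in C(\nu^l):=\prod_iC_i^{\nu^l_i}$. If one of them is unbounded below, in the sense that there is $w$ with $Bw=0$, $Aw\in0^+C(\nu^l)$ (the recession cone) and $d^Tw<0$, return $z^k$ and $\bar\nu=\nu^l$. Otherwise let $z^{k,l}$ be global solutions; if $q(z^{k,l})=q(z^k)$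 for all $l$, return $z^k$ and $\bar\nu=\nu^1$; else set $z^{k+1}=z^{k,l}$ for some $l$ with $q(z^{k,l})<q(z^k)$ and repeat. **Checking algorithm** with input $(\tilde x,\epsilon,\sigma,\eta)$. Let $\tilde{\mathcal A}_i(\tilde x,\epsilon)=\{j\mid\operatorname{dist}(F_i(\tilde x),D_i^j)\le\epsilon\}$ (assumed nonempty), $\tilde{\mathcal I}_i^j(\tilde x,\epsilon)=\{s\mid\langle a^{i,j}_s,F_i(\tilde x)\rangle\ge b^{i,j}_s-\epsilon\}$ and $T_i^j(\tilde x,\epsilon)=\{v\mid\langle a_s^{i,j},v\rangle\le0,\ s\in\tilde{\mathcal I}_i^j(\tilde x,\epsilon)\}$. Let $(\tilde u,\tilde v)$ and $\bar\nu$ be an output of the basic algorithm applied to $$\min_{u,v}\ \langle\nabla f(\tilde x),u\rangle+\tfrac\sigma2\|u\|^2+\tfrac12\|v\|^2\quad\text{s.t.}\quad\nabla F(\tilde x)u+v\in\prod_i\bigcup_{j\in\tilde{\mathcal A}_i(\tilde x,\epsilon)}T_i^j(\tilde x,\epsilon).$$ If $\sigma\|\tilde u\|>\eta$, $\tilde x$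 is not accepted. Otherwise $\tilde x$ is accepted as *approximately M-stationary*, and one computes $\nu^2,\dots,\nu^K\in\prod_i\tilde{\mathcal A}_i(\tilde x,\epsilon)$ with $T_i^{\bar\nu_i}(\tilde x,\epsilon)\cup\bigcup_{l=2}^KT_i^{\nu^l_i}(\tilde x,\epsilon)=\bigcup_{j\in\tilde{\mathcal A}_i(\tilde x,\epsilon)}T_i^j(\tilde x,\epsilon)$ for all $i$. If $$\min\Big\{\langle\nabla f(\tilde x),u\rangle\ \Big|\ \nabla F(\tilde x)u\in\prod_iT_i^{\nu^l_i}(\tilde x,\epsilon),\ \|u\|_\infty\le1\Big\}\ge-\eta$$ for all $l=2,\dots,K$, then $\tilde x$ is accepted as *approximately $\mathcal Q_M$-stationary*; otherwise it is not, and an index $\bar l$ violating this inequality is returned. **Theorem.** Let $\bar x$ be feasible and let $\nabla f$ and $\nabla F$ be Lipschitz near $\bar x$. Let $x_t\to\bar x$ and let $\epsilon_t,\sigma_t,\eta_t>0$ tend to $0$ with $$\lim_{t\to\infty}\frac{\|x_t-\bar x\|}{\epsilon_t}=\lim_{t\to\infty}\frac{\frac{\sigma_t}{\eta_t}+\|x_t-\bar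 x\|}{\eta_t}=0.$$ For each $t$ for which the sets $\tilde{\mathcal A}_i(x_t,\epsilon_t)$ are nonempty, let $(\tilde u_t,\tilde v_t)$, $\bar\nu^t$ and, where applicable, $\nu^{t,2},\dots,\nu^{t,K_t}$ and $\bar l_t$ be an output of the checking algorithm with input $(x_t,\epsilon_t,\sigma_t,\eta_t)$. By convention, whenever the index sets are exact, i.e. the equalities in (i) hold for all $i$, the algorithm's choices are consistent with the sets $\mathcal J_i$: $\bar\nu^t\in\prod_i\mathcal J_i$, and $\{\bar\nu^t_i,\nu^{t,2}_i,\dots,\nu^{t,K_t}_i\}=\mathcal J_i$ for all $i$ if $\nu^{t,2},\dots,\nu^{t,K_t}$ are computed. (i) For all sufficiently large $t$ and all $i$: $\tilde{\mathcal A}_i(x_t,\epsilon_t)=\mathcal A_i$ and $\tilde{\mathcal I}_i^j(x_t,\epsilon_t)=\tilde{\mathcal I}_i^j(\bar x,0)$ for all $j\in\mathcal A_i$. (ii) Assume that $x\rightrightarrows F(x)-D$ is metrically regular near $(\bar x,0)$. Then: (a) If $\bar x$ is B-stationary, then for all sufficiently large $t$ the point $x_t$ is accepted as approximately M-stationary and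 as approximately $\mathcal Q_M$-stationary. (b) If $x_t$ is accepted as approximately M-stationary for infinitely many $t$, then $\bar x$ is M-stationary. (c) If for infinitely many $t$ the point $x_t$ is accepted as approximately $\mathcal Q_M$-stationary and $\{\bar\nu^t,\nu^{t,2},\dots,\nu^{t,K_t}\}\subset\mathcal M(\bar x)$, then $\bar x$ is $\mathcal Q_M$-stationary. (d) For every sufficiently large $t$ such that $x_t$ is not accepted as approximately M-stationary and $\bar\nu^t\in\mathcal M_{sub}(\bar x)$, there is a point $x$ with $F(x)\in D(\bar\nu^t)$ and $f(x)<f(\bar x)$. (e) For every sufficiently large $t$ such that $x_t$ is accepted as approximately M-stationary but not as approximately $\mathcal Q_M$-stationary and $\nu^{t,\bar l_t}\in\mathcal M_{sub}(\bar x)$, there is a point $x$ with $F(x)\in D(\nu^{t,\bar l_t})$ and $f(x)<f(\bar x)$. -/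

import Mathlib

open Set Filter Topology
open scoped ENNReal RealInnerProductSpace

noncomputable section

namespace DisjProg

/-! ### Variational analysis -/

section Variational

variable {V W : Type*} [NormedAddCommGroup V] [InnerProductSpace ℝ V]
  [NormedAddCommGroup W] [InnerProductSpace ℝ W]

/-- The Bouligand (contingent) tangent cone `T_Ω(z)`. -/
def tangentCone (Ω : Set V) (z : V) : Set V :=
  {w | ∃ (ws : ℕ → V) (ts : ℕ → ℝ), Tendsto ws atTop (𝓝 w) ∧ (∀ k, 0 < ts k) ∧
    Tendsto ts atTop (𝓝 0) ∧ ∀ k, z + ts k • ws k ∈ Ω}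

/-- The (negative) polar cone `Q°`. -/
def polarCone (Q : Set V) : Set V := {q' | ∀ q ∈ Q, ⟪q', q⟫ ≤ 0}

/-- The regular (Fréchet) normal cone; it is empty at points outside `Ω`. -/
def regularNormalCone (Ω : Set V) (z : V) : Set V :=
  {v | z ∈ Ω ∧ v ∈ polarCone (tangentCone Ω z)}

/-- The limiting (Mordukhovich) normal cone. -/
def limitingNormalCone (Ω : Set V) (z : V) : Set V :=
  {w | ∃ (zs ws : ℕ → V), Tendsto zs atTop (𝓝 z) ∧ Tendsto ws atTop (𝓝 w) ∧
    ∀ k, ws k ∈ regularNormalCone Ω (zs k)}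

/-- The recession cone `0⁺C`. -/
def recessionCone (C : Set V) : Set V := {w | ∀ y ∈ C, ∀ t : ℝ, 0 ≤ t → y + t • w ∈ C}

/-- The inverse image `Ψ⁻¹(y)` of a multifunction. -/
def multiInv (Ψ : V → Set W) (y : W) : Set V := {x | y ∈ Ψ x}

/-- Metric regularity near a point of the graph. Distances are extended, `dist(x, ∅) = ∞`. -/
def MetricallyRegularNear (Ψ : V → Set W) (x₀ : V) (y₀ : W) : Prop :=
  y₀ ∈ Ψ x₀ ∧ ∃ κ : ℝ, 0 < κ ∧ ∃ U ∈ 𝓝 x₀, ∃ N ∈ 𝓝 y₀, ∀ x ∈ U, ∀ y ∈ N,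
    Metric.infEDist x (multiInv Ψ y) ≤ ENNReal.ofReal κ * Metric.infEDist y (Ψ x)

/-- Metric subregularity at a point of the graph. -/
def MetricallySubregularAt (Ψ : V → Set W) (x₀ : V) (y₀ : W) : Prop :=
  y₀ ∈ Ψ x₀ ∧ ∃ κ : ℝ, 0 < κ ∧ ∃ U ∈ 𝓝 x₀, ∀ x ∈ U,
    Metric.infEDist x (multiInv Ψ y₀) ≤ ENNReal.ofReal κ * Metric.infEDist y₀ (Ψ x)

/-- The constraint multifunction `x ↦ F(x) - D`. -/
def constraintMap (F : V → W) (D : Set W) : V → Set W := fun x => {z | ∃ d ∈ D, z = F x - d}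

end Variational

/-! ### Stationarity for `min f(x)` subject to `F(x) ∈ D` -/

section Stationarity

variable {V W : Type*} [NormedAddCommGroup V] [InnerProductSpace ℝ V] [CompleteSpace V]
  [NormedAddCommGroup W] [InnerProductSpace ℝ W] [CompleteSpace W]

/-- `∇F(x)ᵀ`, the adjoint of the derivative. -/
def gradT (F : V → W) (x : V) : W →L[ℝ] V := ContinuousLinearMap.adjoint (fderiv ℝ F x)

/-- B-stationarity. -/
def BStationary (f : V → ℝ) (F : V → W) (D : Set W) (x : V) : Prop :=
  ∀ u ∈ tangentCone {z | F z ∈ D} x, 0 ≤ ⟪gradient f x, u⟫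

/-- M-stationarity: `-∇f(x) ∈ ∇F(x)ᵀ N_D(F(x))`. -/
def MStationary (f : V → ℝ) (F : V → W) (D : Set W) (x : V) : Prop :=
  -gradient f x ∈ gradT F x '' limitingNormalCone D (F x)

/-- `Q_M`-stationarity with respect to the cones `Q 0, Q 1, …, Q k`:
`-∇f(x) ∈ ∇F(x)ᵀ (N_D(F(x)) ∩ (Q 0)° ∩ ⋂_{l ≥ 1} (ker ∇F(x)ᵀ + (Q l)°))`. -/
def QMStationaryWrt (f : V → ℝ) (F : V → W) (D : Set W) (x : V) {k : ℕ}
    (Q : Fin (k + 1) → Set W) : Prop :=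
  -gradient f x ∈ gradT F x '' (limitingNormalCone D (F x) ∩ polarCone (Q 0) ∩
    ⋂ l : Fin k, {y | ∃ μ q, gradT F x μ = 0 ∧ q ∈ polarCone (Q l.succ) ∧ y = μ + q})

end Stationarity

/-! ### Disjunctive sets

A disjunctive set `∏ᵢ ⋃_{j ∈ I i} C i j`, with finitely many blocks `i`, pieces `C i j` and
admissible piece indices `I i`. -/

section Disjunctive

variable {m : ℕ} {r : Fin m → ℕ} {Y : Fin m → Type*}
  [∀ i, NormedAddCommGroup (Y i)] [∀ i, InnerProductSpace ℝ (Y i)]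

/-- The product `∏ᵢ S i` in the Euclidean product space. -/
def blockProd (S : ∀ i, Set (Y i)) : Set (PiLp 2 Y) := {y | ∀ i, y i ∈ S i}

/-- `∏ᵢ ⋃_{j ∈ I i} C i j`. -/
def disjSet (C : ∀ i, Fin (r i) → Set (Y i)) (I : ∀ i, Set (Fin (r i))) : Set (PiLp 2 Y) :=
  blockProd fun i => ⋃ j ∈ I i, C i j

/-- The branch `∏ᵢ C i (ν i)`. -/
def branch (C : ∀ i, Fin (r i) → Set (Y i)) (ν : ∀ i, Fin (r i)) : Set (PiLp 2 Y) :=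
  blockProd fun i => C i (ν i)

/-- Index sets `J i` of pieces which are active at `y` and satisfy
`T_{⋃_{j ∈ I i} C i j}(y i) = ⋃_{j ∈ J i} T_{C i j}(y i)` for all `i`. -/
def IsActiveChoice (C : ∀ i, Fin (r i) → Set (Y i)) (I : ∀ i, Set (Fin (r i))) (y : PiLp 2 Y)
    (J : ∀ i, Set (Fin (r i))) : Prop :=
  ∀ i, J i ⊆ {j | j ∈ I i ∧ y i ∈ C i j} ∧
    tangentCone (⋃ j ∈ I i, C i j) (y i) = ⋃ j ∈ J i, tangentCone (C i j) (y i)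

/-- `(ν 0, …, ν k)` uses in each block `i` exactly the indices of `J i`. -/
def IsBranchTuple (J : ∀ i, Set (Fin (r i))) {k : ℕ} (ν : Fin (k + 1) → ∀ i, Fin (r i)) : Prop :=
  ∀ i, Set.range (fun l => ν l i) = J i

end Disjunctive

/-! ### Quadratic programs with disjunctive constraints and the basic algorithm -/

/-- Data of the program `min ½⟨z, B z⟩ + ⟨d, z⟩` subject to
`A z ∈ ∏ᵢ ⋃_{j ∈ I i} C i j`, over the Euclidean space `V`. -/
structure QPDC (V : Type*) [NormedAddCommGroup V] [InnerProductSpace ℝ V]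
    {m : ℕ} (r : Fin m → ℕ) (Y : Fin m → Type*)
    [∀ i, NormedAddCommGroup (Y i)] [∀ i, InnerProductSpace ℝ (Y i)] where
  B : V →ₗ[ℝ] V
  d : V
  A : V →ₗ[ℝ] PiLp 2 Y
  C : ∀ i, Fin (r i) → Set (Y i)
  I : ∀ i, Set (Fin (r i))

namespace QPDC

variable {V : Type*} [NormedAddCommGroup V] [InnerProductSpace ℝ V]
  {m : ℕ} {r : Fin m → ℕ} {Y : Fin m → Type*}
  [∀ i, NormedAddCommGroup (Y i)] [∀ i, InnerProductSpace ℝ (Y i)]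

/-- The quadratic objective. -/
def q (P : QPDC V r Y) (z : V) : ℝ := 1 / 2 * ⟪z, P.B z⟫ + ⟪P.d, z⟫

/-- The tuple `ν` may be selected at the iterate `z` (step 2 of the basic algorithm). -/
def Selection (P : QPDC V r Y) (z : V) {k : ℕ} (ν : Fin (k + 1) → ∀ i, Fin (r i)) : Prop :=
  ∃ J, IsActiveChoice P.C P.I (P.A z) J ∧ IsBranchTuple J ν

/-- `z` is a global solution of `min q` subject to `A z ∈ D(ν)`. -/
def SolvesBranch (P : QPDC V r Y) (ν : ∀ i, Fin (r i)) (z : V) : Prop :=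
  P.A z ∈ branch P.C ν ∧ ∀ z', P.A z' ∈ branch P.C ν → P.q z ≤ P.q z'

/-- `w` certifies that `min q` subject to `A z ∈ D(ν)` is unbounded below:
`B w = 0`, `A w ∈ 0⁺D(ν)`, `⟨d, w⟩ < 0`. -/
def UnboundedDir (P : QPDC V r Y) (ν : ∀ i, Fin (r i)) (w : V) : Prop :=
  P.B w = 0 ∧ P.A w ∈ recessionCone (branch P.C ν) ∧ ⟪P.d, w⟫ < 0

/-- The points that can occur as iterates of the basic algorithm. It starts at a feasible point;
at an iterate it selects a tuple of branches, solves all branch programs and moves to one of the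
solutions with a strictly smaller objective value. -/
inductive Iterate (P : QPDC V r Y) : V → Prop
  | start (z : V) (hz : P.A z ∈ disjSet P.C P.I) : Iterate P z
  | step (z : V) (k : ℕ) (ν : Fin (k + 1) → ∀ i, Fin (r i)) (s : Fin (k + 1) → V)
      (l : Fin (k + 1)) (hz : Iterate P z) (hν : P.Selection z ν)
      (hs : ∀ l', P.SolvesBranch (ν l') (s l')) (hl : P.q (s l) < P.q z) : Iterate P (s l)

/-- `(z, ν̄)` can be the output of the basic algorithm: it stops at an iterate `z` either because
some selected branch program is unbounded below, and returns that branch, or because `z` has the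
same objective value as the solutions of all selected branch programs, and returns the first
branch. -/
inductive BasicOutput (P : QPDC V r Y) : V → (∀ i, Fin (r i)) → Prop
  | unbounded (z : V) (k : ℕ) (ν : Fin (k + 1) → ∀ i, Fin (r i)) (l : Fin (k + 1)) (w : V)
      (hz : P.Iterate z) (hν : P.Selection z ν) (hw : P.UnboundedDir (ν l) w) :
      BasicOutput P z (ν l)
  | stationary (z : V) (k : ℕ) (ν : Fin (k + 1) → ∀ i, Fin (r i)) (s : Fin (k + 1) → V)
      (hz : P.Iterate z) (hν : P.Selection z ν) (hs : ∀ l, P.SolvesBranch (ν l) (s l))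
      (heq : ∀ l, P.q z = P.q (s l)) : BasicOutput P z (ν 0)

end QPDC

/-! ### Mathematical programs with disjunctive constraints -/

/-- The program `min f(x)` subject to `F i x ∈ ⋃_j D_i^j` for all `i < mD`, where
`D_i^j = {y | ⟨a i j s, y⟩ ≤ b i j s for all s}` is polyhedral, with `‖a i j s‖ = 1`,
and `f`, `F i` are continuously differentiable. -/
structure MPDC (n mD : ℕ) where
  dim : Fin mD → ℕ
  numPieces : Fin mD → ℕ
  numIneq : ∀ i, Fin (numPieces i) → ℕ
  a : ∀ i j, Fin (numIneq i j) → EuclideanSpace ℝ (Fin (dim i))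
  b : ∀ i j, Fin (numIneq i j) → ℝ
  norm_a : ∀ i j s, ‖a i j s‖ = 1
  f : EuclideanSpace ℝ (Fin n) → ℝ
  F : ∀ i, EuclideanSpace ℝ (Fin n) → EuclideanSpace ℝ (Fin (dim i))
  contDiff_f : ContDiff ℝ 1 f
  contDiff_F : ∀ i, ContDiff ℝ 1 (F i)

namespace MPDC

variable {n mD : ℕ} (P : MPDC n mD)

/-- The constraint block `ℝ^{l_i}`. -/
abbrev Block (i : Fin mD) : Type := EuclideanSpace ℝ (Fin (P.dim i))

/-- The image space `ℝ^m = ∏ᵢ ℝ^{l_i}` with the Euclidean norm. -/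
abbrev Img : Type := PiLp 2 P.Block

/-- Index vectors `ν = (ν_1, …, ν_{m_D})` with `ν_i ∈ {1, …, K_i}`. -/
abbrev Branch : Type := ∀ i, Fin (P.numPieces i)

/-- `F = (F_1, …, F_{m_D})`. -/
def Fall (x : EuclideanSpace ℝ (Fin n)) : P.Img := WithLp.toLp 2 fun i => P.F i x

/-- The convex polyhedral set `D_i^j`. -/
def piece (i : Fin mD) (j : Fin (P.numPieces i)) : Set (P.Block i) :=
  {y | ∀ s, ⟪P.a i j s, y⟫ ≤ P.b i j s}

/-- `D = ∏ᵢ ⋃_j D_i^j`. -/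
def D : Set P.Img := disjSet P.piece fun _ => Set.univ

/-- `D(ν) = ∏ᵢ D_i^{ν_i}`. -/
def Dbranch (ν : P.Branch) : Set P.Img := branch P.piece ν

/-- `𝒜_i(y)`, the indices of the sets `D_i^j` which contain `y_i`. -/
def active (y : P.Img) (i : Fin mD) : Set (Fin (P.numPieces i)) := {j | y i ∈ P.piece i j}

/-- Index sets `𝒥_i(y) ⊆ 𝒜_i(y)` with `T_{D_i}(y_i) = ⋃_{j ∈ 𝒥_i(y)} T_{D_i^j}(y_i)`. -/
def IsIndexChoice (y : P.Img) (J : ∀ i, Set (Fin (P.numPieces i))) : Prop :=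
  IsActiveChoice P.piece (fun _ => Set.univ) y J

/-- `Q_M`-stationarity for the disjunctive program, for chosen index sets `𝒥_i(F(x)) = J i`: there
are `ν^1, …, ν^K` with `{ν^1_i, …, ν^K_i} = J i` for all `i` such that `x` is `Q_M`-stationary with
respect to the cones `T_{D(ν^l)}(F(x))`. -/
def QMStationary (J : ∀ i, Set (Fin (P.numPieces i))) (x : EuclideanSpace ℝ (Fin n)) : Prop :=
  ∃ (k : ℕ) (ν : Fin (k + 1) → P.Branch), IsBranchTuple J ν ∧
    QMStationaryWrt P.f P.Fall P.D x fun l => tangentCone (P.Dbranch (ν l)) (P.Fall x)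

/-- The set `ℳ(x)` of all `ν` with `ν_i ∈ J i` such that `F(·) - D(ν)` is metrically regular
near `(x, 0)`. -/
def regBranches (J : ∀ i, Set (Fin (P.numPieces i))) (x : EuclideanSpace ℝ (Fin n)) :
    Set P.Branch :=
  {ν | (∀ i, ν i ∈ J i) ∧ MetricallyRegularNear (constraintMap P.Fall (P.Dbranch ν)) x 0}

/-- The set `ℳ_sub(x)` of all `ν` with `ν_i ∈ J i` such that `F(·) - D(ν)` is metrically
subregular at `(x, 0)`. -/
def subregBranches (J : ∀ i, Set (Fin (P.numPieces i))) (x : EuclideanSpace ℝ (Fin n)) :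
    Set P.Branch :=
  {ν | (∀ i, ν i ∈ J i) ∧ MetricallySubregularAt (constraintMap P.Fall (P.Dbranch ν)) x 0}

/-! #### The checking algorithm -/

/-- The `ε`-active index sets `𝒜̃_i(x, ε)` (the distance to an empty piece is `∞`). -/
def epsActive (x : EuclideanSpace ℝ (Fin n)) (ε : ℝ) (i : Fin mD) : Set (Fin (P.numPieces i)) :=
  {j | Metric.infEDist (P.F i x) (P.piece i j) ≤ ENNReal.ofReal ε}

/-- The `ε`-active inequalities `ℐ̃_i^j(x, ε)`. -/
def epsIneq (x : EuclideanSpace ℝ (Fin n)) (ε : ℝ) (i : Fin mD) (j : Fin (P.numPieces i)) :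
    Set (Fin (P.numIneq i j)) :=
  {s | P.b i j s - ε ≤ ⟪P.a i j s, P.F i x⟫}

/-- The polyhedral cones `T_i^j(x, ε)`. -/
def epsCone (x : EuclideanSpace ℝ (Fin n)) (ε : ℝ) (i : Fin mD) (j : Fin (P.numPieces i)) :
    Set (P.Block i) :=
  {v | ∀ s ∈ P.epsIneq x ε i j, ⟪P.a i j s, v⟫ ≤ 0}

/-- The space of the pairs `(u, v) ∈ ℝ^n × ℝ^m`. -/
abbrev UV : Type := WithLp 2 (EuclideanSpace ℝ (Fin n) × P.Img)

/-- The auxiliary program with objective `⟨∇f(x), u⟩ + (σ/2)‖u‖² + ½‖v‖²` and constraint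
`∇F(x) u + v ∈ ∏ᵢ ⋃_{j ∈ 𝒜̃_i(x, ε)} T_i^j(x, ε)`. -/
def auxQPDC (x : EuclideanSpace ℝ (Fin n)) (ε σ : ℝ) : QPDC P.UV P.numPieces P.Block where
  B := (WithLp.linearEquiv 2 ℝ (EuclideanSpace ℝ (Fin n) × P.Img)).symm.toLinearMap ∘ₗ
    ((σ • LinearMap.id).prodMap LinearMap.id) ∘ₗ
    (WithLp.linearEquiv 2 ℝ (EuclideanSpace ℝ (Fin n) × P.Img)).toLinearMap
  d := WithLp.toLp 2 (gradient P.f x, 0)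
  A := ((fderiv ℝ P.Fall x).toLinearMap.coprod LinearMap.id) ∘ₗ
    (WithLp.linearEquiv 2 ℝ (EuclideanSpace ℝ (Fin n) × P.Img)).toLinearMap
  C := P.epsCone x ε
  I := P.epsActive x ε

theorem auxQPDC_q (x : EuclideanSpace ℝ (Fin n)) (ε σ : ℝ) (u : EuclideanSpace ℝ (Fin n))
    (v : P.Img) : (P.auxQPDC x ε σ).q (WithLp.toLp 2 (u, v)) =
      ⟪gradient P.f x, u⟫ + σ / 2 * ‖u‖ ^ 2 + 1 / 2 * ‖v‖ ^ 2 := by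
  simp only [QPDC.q, auxQPDC, WithLp.prod_inner_apply]
  simp [real_inner_smul_right]
  ring

theorem auxQPDC_A (x : EuclideanSpace ℝ (Fin n)) (ε σ : ℝ) (u : EuclideanSpace ℝ (Fin n))
    (v : P.Img) : (P.auxQPDC x ε σ).A (WithLp.toLp 2 (u, v)) = fderiv ℝ P.Fall x u + v := by
  simp [auxQPDC]

/-- The branch test `min {⟨∇f(x), u⟩ | ∇F(x) u ∈ ∏ᵢ T_i^{ν_i}(x, ε), ‖u‖_∞ ≤ 1} ≥ -η`. -/
def LPTest (x : EuclideanSpace ℝ (Fin n)) (ε η : ℝ) (ν : P.Branch) : Prop :=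
  ∀ u : EuclideanSpace ℝ (Fin n), fderiv ℝ P.Fall x u ∈ branch (P.epsCone x ε) ν →
    (∀ i, -1 ≤ u i ∧ u i ≤ 1) → -η ≤ ⟪gradient P.f x, u⟫

/-- The decision of the checking algorithm.
* `rejectM`: not accepted as approximately M-stationary;
* `acceptQM k ν`: accepted as approximately M-stationary, the branches `ν^2, …, ν^K` (`K = k + 1`)
  were computed, and the point was accepted as approximately `Q_M`-stationary;
* `rejectQM k ν l`: accepted as approximately M-stationary, `ν^2, …, ν^K` were computed, and the
  point was not accepted as approximately `Q_M`-stationary, the branch `ν l` violating the test. -/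
inductive Verdict : Type
  | rejectM : Verdict
  | acceptQM (k : ℕ) (ν : Fin k → P.Branch) : Verdict
  | rejectQM (k : ℕ) (ν : Fin k → P.Branch) (l : Fin k) : Verdict

/-- An output `(ũ, ṽ)`, `ν̄` of the checking algorithm, together with its decision. -/
structure CheckOutput where
  u : EuclideanSpace ℝ (Fin n)
  v : P.Img
  nubar : P.Branch
  verdict : P.Verdict

namespace CheckOutput

variable {P}

/-- Accepted as approximately M-stationary. -/
def AcceptedM (o : P.CheckOutput) : Prop := o.verdict ≠ Verdict.rejectM

/-- Accepted as approximately `Q_M`-stationary. -/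
def AcceptedQM (o : P.CheckOutput) : Prop :=
  ∃ (k : ℕ) (ν : Fin k → P.Branch), o.verdict = Verdict.acceptQM k ν

/-- `ν^2, …, ν^K` are the branches computed after acceptance as approximately M-stationary. -/
def Computed (o : P.CheckOutput) {k : ℕ} (ν : Fin k → P.Branch) : Prop :=
  o.verdict = Verdict.acceptQM k ν ∨ ∃ l, o.verdict = Verdict.rejectQM k ν l

end CheckOutput

/-- The branches `ν^2, …, ν^K` are admissible in the last step of the checking algorithm:
`ν^l_i ∈ 𝒜̃_i(x, ε)` and
`T_i^{ν̄_i} ∪ ⋃_{l ≥ 2} T_i^{ν^l_i} = ⋃_{j ∈ 𝒜̃_i(x, ε)} T_i^j` for all `i`. -/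
def IsCover (x : EuclideanSpace ℝ (Fin n)) (ε : ℝ) (nubar : P.Branch) {k : ℕ}
    (ν : Fin k → P.Branch) : Prop :=
  (∀ l i, ν l i ∈ P.epsActive x ε i) ∧
  ∀ i, P.epsCone x ε i (nubar i) ∪ ⋃ l, P.epsCone x ε i (ν l i) =
    ⋃ j ∈ P.epsActive x ε i, P.epsCone x ε i j

/-- `o` is a possible output of the checking algorithm with input `(x, ε, σ, η)`. -/
def IsCheckOutput (x : EuclideanSpace ℝ (Fin n)) (ε σ η : ℝ) (o : P.CheckOutput) : Prop :=
  (∀ i, (P.epsActive x ε i).Nonempty) ∧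
  (P.auxQPDC x ε σ).BasicOutput (WithLp.toLp 2 (o.u, o.v)) o.nubar ∧
  match o.verdict with
  | .rejectM => η < σ * ‖o.u‖
  | .acceptQM _ ν => σ * ‖o.u‖ ≤ η ∧ P.IsCover x ε o.nubar ν ∧ ∀ l, P.LPTest x ε η (ν l)
  | .rejectQM _ ν l => σ * ‖o.u‖ ≤ η ∧ P.IsCover x ε o.nubar ν ∧ ¬ P.LPTest x ε η (ν l)

/-- The `ε`-active index sets at `x` are the active index sets at `x₀`. -/
def ExactIndexSets (x₀ x : EuclideanSpace ℝ (Fin n)) (ε : ℝ) : Prop :=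
  ∀ i, P.epsActive x ε i = P.active (P.Fall x₀) i ∧
    ∀ j ∈ P.active (P.Fall x₀) i, P.epsIneq x ε i j = P.epsIneq x₀ 0 i j

/-- The indices in the output are consistent with the index sets `J i` chosen at the limit point:
`ν̄ ∈ ∏ᵢ J i`, and `{ν̄_i, ν^2_i, …, ν^K_i} = J i` for all `i` whenever `ν^2, …, ν^K` were
computed. -/
def Consistent (J : ∀ i, Set (Fin (P.numPieces i))) (o : P.CheckOutput) : Prop :=
  (∀ i, o.nubar i ∈ J i) ∧ ∀ (k : ℕ) (ν : Fin k → P.Branch), o.Computed ν →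
    IsBranchTuple J (Fin.cons o.nubar ν : Fin (k + 1) → P.Branch)

end MPDC

end DisjProg

end

/-!
The theorem rests on linearizing metric (sub)regularity of `x ↦ F(x) - D` in tangential form, and on
the polyhedral structure of the pieces, by which `D - F(x₀)` coincides near `0` with the tangent cone
`T = T_D(F(x₀))`.

Since `ε t` dominates `‖x t - x₀‖`, the `ε`-active index sets at `x t` are eventually the active index
sets at `x₀` (`MPDC.eventually_exactIndexSets`), and the cones used by the checking algorithm are the
tangent cones at `F(x₀)`. The auxiliary objective being strictly convex, the basic algorithm can only
stop at a solution `(u, v)` of all selected branch programs, and first-order optimality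
(`MPDC.optimality_of_basicOutput`) gives `⟨∇f(x t), u⟩ = -(σ ‖u‖² + ‖v‖²)` and shows that `-v` is a
multiplier for `-∇f(x t) - σ u` which is a regular normal to `T` at a point of `T`, hence a regular
normal to `D` at points arbitrarily close to `F(x₀)` (`MPDC.exists_mem_regularNormalCone_D`).

*From B-stationarity to acceptance.* Metric subregularity gives an error bound for the tangent cone
of the feasible set (`MetricallySubregularAt.linearization`). If `x₀` is B-stationary, moving `u` into
that tangent cone shows `⟨∇f(x t), u⟩ ≥ -c (‖v‖ + ‖x t - x₀‖ ‖u‖)`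
(`BStationary.eventually_le_inner_gradient`). Combined with the formula for `⟨∇f(x t), u⟩` and the
rates, this forces `σ ‖u‖ ≤ η`; with `v = 0` it gives the branch tests. The same applied to a single
branch `D(ν)` in place of `D` shows that a failing test on a subregular branch is incompatible with
`x₀` minimizing `f` on that branch.

*From acceptance to stationarity.* Metric regularity bounds regular normals `l` to `D` near `F(x₀)` by
`κ ‖∇F(x)ᵀ l‖` (`MetricallyRegularNear.norm_le`), so the multipliers `-v` have a cluster point, which
is an M-multiplier at `x₀` and stays polar to the branch `ν̄`. For the other branches, metric
regularity lets the tests pass to the limit (`MetricallyRegularNear.inner_gradient_nonneg`), and a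
Farkas type argument (`exists_polarCone_map_eq`), whose closedness condition is again the bound on the
normals, produces multipliers polar to those branches. They differ from the M-multiplier by an element
of the kernel of `∇F(x₀)ᵀ`.
-/

namespace DisjProg

/-! ### Linearizing metric regularity -/

section Linearization

theorem MetricallyRegularNear.metricallySubregularAt {V W : Type*} [NormedAddCommGroup V]
    [NormedAddCommGroup W] {Ψ : V → Set W} {x₀ : V} {y₀ : W}
    (h : MetricallyRegularNear Ψ x₀ y₀) : MetricallySubregularAt Ψ x₀ y₀ := by
  obtain ⟨h₀, κ, hκ, U, hU, N, hN, h⟩ := h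
  exact ⟨h₀, κ, hκ, U, hU, fun x hx => h x hx y₀ (mem_of_mem_nhds hN)⟩

variable {V W : Type*} [NormedAddCommGroup V] [InnerProductSpace ℝ V]
  [NormedAddCommGroup W] [InnerProductSpace ℝ W]

theorem tangentCone_mono {Ω Ω' : Set V} (h : Ω ⊆ Ω') (z : V) :
    tangentCone Ω z ⊆ tangentCone Ω' z := by
  rintro w ⟨ws, ts, h₁, h₂, h₃, h₄⟩
  exact ⟨ws, ts, h₁, h₂, h₃, fun k => h (h₄ k)⟩

theorem isClosed_polarCone (Q : Set V) : IsClosed (polarCone Q) := by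
  have : polarCone Q = ⋂ q ∈ Q, {q' : V | ⟪q', q⟫ ≤ 0} := by
    ext; simp [polarCone]
  rw [this]
  exact isClosed_biInter fun q _ =>
    isClosed_le (continuous_id.inner continuous_const) continuous_const

/-- Points `x k + s k • w k ∈ E k` whose increments `w k` converge can be found along a
subsequence as soon as the distance of `x k` to `E k` is of order `s k`. -/
theorem exists_tendsto_increment [FiniteDimensional ℝ V] {x : ℕ → V} {E : ℕ → Set V}
    {s r : ℕ → ℝ} {ρ κ : ℝ} (hκ : 0 ≤ κ) (hs : ∀ k, 0 < s k) (hr₀ : ∀ k, 0 ≤ r k)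
    (hr : Tendsto r atTop (𝓝 ρ))
    (h : ∀ k, Metric.infEDist (x k) (E k) ≤ ENNReal.ofReal (κ * (s k * r k))) :
    ∃ (φ : ℕ → ℕ) (w : ℕ → V) (w₀ : V), StrictMono φ ∧ Tendsto w atTop (𝓝 w₀) ∧
      ‖w₀‖ ≤ κ * ρ ∧ ∀ k, x (φ k) + s (φ k) • w k ∈ E (φ k) := by
  have hex : ∀ k, ∃ w : V, ‖w‖ ≤ κ * r k + 1 / ((k : ℝ) + 1) ∧ x k + s k • w ∈ E k := by
    intro k
    have hk : (0 : ℝ) < 1 / ((k : ℝ) + 1) := by positivity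
    have hlt : Metric.infEDist (x k) (E k) <
        ENNReal.ofReal (s k * (κ * r k + 1 / ((k : ℝ) + 1))) := by
      refine (h k).trans_lt ((ENNReal.ofReal_lt_ofReal_iff ?_).2 ?_)
      · have := hs k; have := hr₀ k; positivity
      · have := mul_pos (hs k) hk
        nlinarith
    obtain ⟨y, hy, hyd⟩ := Metric.infEDist_lt_iff.1 hlt
    refine ⟨(s k)⁻¹ • (y - x k), ?_, ?_⟩
    · rw [edist_comm, edist_dist, ENNReal.ofReal_lt_ofReal_iff_of_nonneg dist_nonneg,
        dist_eq_norm] at hyd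
      rw [norm_smul, norm_inv, Real.norm_of_nonneg (hs k).le, inv_mul_le_iff₀ (hs k)]
      exact hyd.le
    · rw [smul_inv_smul₀ (hs k).ne']
      simpa using hy
  choose w hw hwE using hex
  have hlim : Tendsto (fun k : ℕ => κ * r k + 1 / ((k : ℝ) + 1)) atTop (𝓝 (κ * ρ)) := by
    simpa using (hr.const_mul κ).add tendsto_one_div_add_atTop_nhds_zero_nat
  obtain ⟨M, hM⟩ := hlim.bddAbove_range
  have hb : ∀ k, w k ∈ Metric.closedBall (0 : V) M := fun k =>
    mem_closedBall_zero_iff.2 ((hw k).trans (hM ⟨k, rfl⟩))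
  obtain ⟨w₀, -, φ, hφ, hφw⟩ := tendsto_subseq_of_bounded Metric.isBounded_closedBall hb
  exact ⟨φ, w ∘ φ, w₀, hφ, hφw,
    le_of_tendsto_of_tendsto' hφw.norm (hlim.comp hφ.tendsto_atTop) fun k => hw _,
    fun k => hwE _⟩

/-- Difference quotients along converging increments converge to the directional derivative. -/
theorem tendsto_difference_quotient {F : V → W} {x : V} (hF : DifferentiableAt ℝ F x)
    {s : ℕ → ℝ} {w : ℕ → V} {w₀ : V} (hs : ∀ k, 0 < s k) (hs₀ : Tendsto s atTop (𝓝 0))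
    (hw : Tendsto w atTop (𝓝 w₀)) :
    Tendsto (fun k => (s k)⁻¹ • (F (x + s k • w k) - F x)) atTop (𝓝 (fderiv ℝ F x w₀)) := by
  refine (hasFDerivWithinAt_univ.2 hF.hasFDerivAt).lim (d := fun k => s k • w k)
    ?_ (.of_forall fun _ => mem_univ _) ?_
  · simpa using hs₀.smul hw
  · refine hw.congr fun k => ?_
    rw [inv_smul_smul₀ (hs k).ne']

/-- Metric regularity of `F(·) - D` passes to the linearizations at nearby points `x` and nearby
`y ∈ D`: every `e` is of the form `∇F(x) w - τ` with `τ ∈ T_D(y)` and `‖w‖ ≤ κ ‖e‖`. -/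
theorem MetricallyRegularNear.linearization [FiniteDimensional ℝ V] {F : V → W} {D : Set W}
    {x₀ : V} (hF : Differentiable ℝ F) (h : MetricallyRegularNear (constraintMap F D) x₀ 0) :
    ∃ κ : ℝ, 0 < κ ∧ ∀ᶠ p : V × W in 𝓝 (x₀, F x₀), p.2 ∈ D →
      ∀ e, ∃ w, ‖w‖ ≤ κ * ‖e‖ ∧ fderiv ℝ F p.1 w - e ∈ tangentCone D p.2 := by
  obtain ⟨-, κ, hκ, U, hU, N, hN, h⟩ := h
  refine ⟨κ, hκ, ?_⟩
  have hU' : ∀ᶠ p : V × W in 𝓝 (x₀, F x₀), p.1 ∈ U := (continuous_fst.tendsto (x₀, F x₀)) hU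
  have hN' : ∀ᶠ p : V × W in 𝓝 (x₀, F x₀), F p.1 - p.2 ∈ interior N := by
    have hc : Continuous fun p : V × W => F p.1 - p.2 :=
      (hF.continuous.comp continuous_fst).sub continuous_snd
    refine (hc.tendsto (x₀, F x₀)) ?_
    simpa using hN
  filter_upwards [hU', hN']
  rintro ⟨x, y⟩ hx hxy hy e
  dsimp only at hx hxy hy ⊢
  have hlim : Tendsto (fun s : ℝ => F x - y + s • e) (𝓝 0) (𝓝 (F x - y)) := by
    have : Continuous fun s : ℝ => F x - y + s • e := by fun_prop
    simpa using this.tendsto 0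
  have hev : ∀ᶠ s : ℝ in 𝓝 0, F x - y + s • e ∈ N :=
    (hlim.eventually_mem (isOpen_interior.mem_nhds hxy)).mono fun s hs => interior_subset hs
  obtain ⟨δ, hδ, hδN⟩ := Metric.eventually_nhds_iff.1 hev
  let s : ℕ → ℝ := fun k => (δ / 2) * (1 / ((k : ℝ) + 1))
  have hs : ∀ k, 0 < s k := fun k => by positivity
  have hs₀ : Tendsto s atTop (𝓝 0) := by
    have := (tendsto_one_div_add_atTop_nhds_zero_nat (𝕜 := ℝ)).const_mul (δ / 2)
    rwa [mul_zero] at this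
  have hsN : ∀ k, F x - y + s k • e ∈ N := fun k => hδN (by
    rw [Real.dist_eq, sub_zero, abs_of_pos (hs k)]
    have : 1 / ((k : ℝ) + 1) ≤ 1 := by
      rw [div_le_one (by positivity)]; linarith [(Nat.cast_nonneg k : (0 : ℝ) ≤ k)]
    show (δ / 2) * (1 / ((k : ℝ) + 1)) < δ
    nlinarith)
  -- `x` is kept fixed, while the value `F x - y` of the multifunction at `x` is perturbed to
  -- `F x - y + s k • e`: regularity yields solutions `x + s k • w k` of the perturbed inclusion
  obtain ⟨φ, w, w₀, hφ, hw, hw₀, hmem⟩ := exists_tendsto_increment (x := fun _ => x)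
    (E := fun k => multiInv (constraintMap F D) (F x - y + s k • e)) (s := s)
    (r := fun _ => ‖e‖) hκ.le hs (fun _ => norm_nonneg _) tendsto_const_nhds (fun k => by
      refine (h x hx _ (hsN k)).trans ?_
      rw [ENNReal.ofReal_mul hκ.le]
      gcongr
      have hmem : F x - y ∈ constraintMap F D x := ⟨y, hy, rfl⟩
      refine (Metric.infEDist_le_edist_of_mem hmem).trans ?_
      rw [edist_dist, dist_eq_norm, add_sub_cancel_left, norm_smul, Real.norm_of_nonneg (hs k).le])
  have hsφ := hs₀.comp hφ.tendsto_atTop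
  refine ⟨w₀, hw₀, fun k => (s (φ k))⁻¹ • (F (x + s (φ k) • w k) - F x) - e, s ∘ φ,
    (tendsto_difference_quotient (hF x) (fun k => hs _) hsφ hw).sub_const e,
    fun k => hs _, hsφ, fun k => ?_⟩
  obtain ⟨d, hd, hd'⟩ := hmem k
  convert hd using 1
  rw [Function.comp_apply, smul_sub, smul_inv_smul₀ (hs _).ne', ← sub_eq_zero]
  rw [← sub_eq_zero] at hd'
  rw [← neg_eq_zero, ← hd']
  abel

/-- Metric subregularity of `F(·) - D` linearizes at `(x₀, F(x₀))` to an error bound for the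
tangent cone of the feasible set. -/
theorem MetricallySubregularAt.linearization [FiniteDimensional ℝ V] {F : V → W} {D : Set W}
    {x₀ : V} (hF : Differentiable ℝ F) (h : MetricallySubregularAt (constraintMap F D) x₀ 0) :
    ∃ κ : ℝ, 0 < κ ∧ ∀ u, ∀ p ∈ tangentCone D (F x₀), ∃ w, ‖w‖ ≤ κ * ‖fderiv ℝ F x₀ u - p‖ ∧
      u + w ∈ tangentCone {z | F z ∈ D} x₀ := by
  obtain ⟨-, κ, hκ, U, hU, h⟩ := h
  refine ⟨κ, hκ, ?_⟩
  rintro u p ⟨ps, s, hp, hs, hs₀, hD⟩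
  have hxU : ∀ᶠ k in atTop, x₀ + s k • u ∈ U := by
    have : Tendsto (fun k => x₀ + s k • u) atTop (𝓝 x₀) := by
      simpa using (hs₀.smul_const u).const_add x₀
    exact this hU
  obtain ⟨n₀, hn₀⟩ := eventually_atTop.1 hxU
  have hq := tendsto_difference_quotient (hF x₀) hs hs₀ (tendsto_const_nhds (x := u))
  have hshift : Tendsto (fun k : ℕ => k + n₀) atTop atTop := tendsto_add_atTop_nat n₀
  obtain ⟨φ, w, w₀, hφ, hw, hw₀, hmem⟩ := exists_tendsto_increment
    (x := fun k => x₀ + s (k + n₀) • u) (E := fun _ => {z | F z ∈ D})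
    (s := fun k => s (k + n₀))
    (r := fun k => ‖(s (k + n₀))⁻¹ • (F (x₀ + s (k + n₀) • u) - F x₀) - ps (k + n₀)‖)
    hκ.le (fun k => hs _) (fun _ => norm_nonneg _) ((hq.sub hp).norm.comp hshift) (fun k => by
      have hset : {z | F z ∈ D} = multiInv (constraintMap F D) 0 := by
        ext z
        constructor
        · exact fun hz => ⟨F z, hz, (sub_self _).symm⟩
        · rintro ⟨d, hd, hd'⟩
          rwa [mem_ofPred_eq, sub_eq_zero.1 hd'.symm]
      rw [hset]
      refine (h _ (hn₀ _ (Nat.le_add_left _ _))).trans ?_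
      rw [ENNReal.ofReal_mul hκ.le]
      gcongr
      have hmem : F (x₀ + s (k + n₀) • u) - (F x₀ + s (k + n₀) • ps (k + n₀)) ∈
          constraintMap F D (x₀ + s (k + n₀) • u) := ⟨_, hD _, rfl⟩
      refine (Metric.infEDist_le_edist_of_mem hmem).trans (le_of_eq ?_)
      rw [edist_dist, dist_eq_norm, zero_sub, norm_neg]
      congr 1
      rw [← Real.norm_of_nonneg (hs (k + n₀)).le, ← norm_smul,
        Real.norm_of_nonneg (hs (k + n₀)).le, smul_sub, smul_inv_smul₀ (hs _).ne', sub_sub])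
  refine ⟨w₀, hw₀, fun k => u + w k, fun k => s (φ k + n₀), hw.const_add u, fun k => hs _,
    hs₀.comp (hshift.comp hφ.tendsto_atTop), fun k => ?_⟩
  simpa [smul_add, add_assoc] using hmem k

end Linearization

/-! ### Multipliers and stationarity -/

section Stationarity

variable {V W : Type*} [NormedAddCommGroup V] [InnerProductSpace ℝ V]
  [NormedAddCommGroup W] [InnerProductSpace ℝ W] [FiniteDimensional ℝ V]

/-- Along directions `u` for which `∇F(x) u` is `v`-close to the tangent cone `T_D(F(x₀))`,
the objective of a program with a B-stationary point `x₀` decreases at most at a rate of order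
`‖v‖ + ‖x - x₀‖ ‖u‖`. -/
theorem BStationary.eventually_le_inner_gradient {f : V → ℝ} {F : V → W} {D : Set W} {x₀ : V}
    (hF : Differentiable ℝ F)
    (hLip : ∃ U ∈ 𝓝 x₀, ∃ L : NNReal,
      LipschitzOnWith L (gradient f) U ∧ LipschitzOnWith L (fderiv ℝ F) U)
    (hsub : MetricallySubregularAt (constraintMap F D) x₀ 0) (hB : BStationary f F D x₀) :
    ∃ c : ℝ, 0 < c ∧ ∀ᶠ x in 𝓝 x₀, ∀ u v, fderiv ℝ F x u + v ∈ tangentCone D (F x₀) →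
      -(c * (‖v‖ + ‖x - x₀‖ * ‖u‖)) ≤ ⟪gradient f x, u⟫ := by
  obtain ⟨U, hU, L, hLf, hLF⟩ := hLip
  obtain ⟨κ, hκ, h⟩ := hsub.linearization hF
  set g := ‖gradient f x₀‖ with hg
  refine ⟨g * κ * (1 + L) + L + 1, by positivity, ?_⟩
  filter_upwards [hU] with x hx u v huv
  have hx₀ := mem_of_mem_nhds hU
  obtain ⟨w, hw, hwT⟩ := h u _ huv
  have h₁ := hB _ hwT
  have hdF : ‖(fderiv ℝ F x - fderiv ℝ F x₀) u‖ ≤ L * ‖x - x₀‖ * ‖u‖ :=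
    (ContinuousLinearMap.le_opNorm _ _).trans
      (mul_le_mul_of_nonneg_right (hLF.norm_sub_le hx hx₀) (norm_nonneg _))
  have hdf : ‖gradient f x - gradient f x₀‖ ≤ L * ‖x - x₀‖ := hLf.norm_sub_le hx hx₀
  have h₂ : ‖fderiv ℝ F x₀ u - (fderiv ℝ F x u + v)‖ ≤ L * ‖x - x₀‖ * ‖u‖ + ‖v‖ := by
    have : fderiv ℝ F x₀ u - (fderiv ℝ F x u + v) = -((fderiv ℝ F x - fderiv ℝ F x₀) u + v) := by
      simp only [sub_apply]; abel
    rw [this, norm_neg]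
    exact (norm_add_le _ _).trans (by gcongr)
  have h₃ : ‖w‖ ≤ κ * (L * ‖x - x₀‖ * ‖u‖ + ‖v‖) := hw.trans (by gcongr)
  have h₄ := (abs_le.1 (abs_real_inner_le_norm (gradient f x₀) w)).2
  have h₅ := (abs_le.1 (abs_real_inner_le_norm (gradient f x - gradient f x₀) u)).1
  rw [inner_add_right] at h₁
  rw [inner_sub_left] at h₅
  have h₆ : ‖gradient f x - gradient f x₀‖ * ‖u‖ ≤ L * ‖x - x₀‖ * ‖u‖ := by gcongr
  have h₇ : g * ‖w‖ ≤ g * (κ * (L * ‖x - x₀‖ * ‖u‖ + ‖v‖)) := by gcongr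
  have hA : 0 ≤ ‖x - x₀‖ * ‖u‖ := by positivity
  have hL : (0 : ℝ) ≤ L := L.2
  have e₁ : 0 ≤ g * κ * (‖x - x₀‖ * ‖u‖) := by positivity
  have e₂ : 0 ≤ g * κ * L * ‖v‖ := by positivity
  have e₃ : 0 ≤ L * ‖v‖ := by positivity
  nlinarith [norm_nonneg v]

/-- Global minimizers are B-stationary. -/
theorem bStationary_of_forall_le {V W : Type*} [NormedAddCommGroup V] [InnerProductSpace ℝ V]
    [FiniteDimensional ℝ V] {f : V → ℝ} {F : V → W} {D : Set W} {x₀ : V}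
    (hf : Differentiable ℝ f) (h : ∀ z, F z ∈ D → f x₀ ≤ f z) : BStationary f F D x₀ := by
  rintro u ⟨us, s, hu, hs, hs₀, hD⟩
  have hq := tendsto_difference_quotient (hf x₀) hs hs₀ hu
  rw [show fderiv ℝ f x₀ u = ⟪gradient f x₀, u⟫ by simp [gradient]] at hq
  refine ge_of_tendsto' hq fun k => ?_
  exact smul_nonneg (inv_nonneg.2 (hs k).le) (sub_nonneg.2 (h _ (hD k)))

variable [FiniteDimensional ℝ W]

theorem gradT_inner (F : V → W) (x : V) (y : W) (u : V) :
    ⟪gradT F x y, u⟫ = ⟪y, fderiv ℝ F x u⟫ :=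
  ContinuousLinearMap.adjoint_inner_left _ _ _

/-- The normal cone form of metric regularity: regular normals `l` to `D` near `F(x₀)` are bounded
by `κ ‖∇F(x)ᵀ l‖`, for `x` near `x₀`. -/
theorem MetricallyRegularNear.norm_le {F : V → W} {D : Set W} {x₀ : V}
    (hF : Differentiable ℝ F) (h : MetricallyRegularNear (constraintMap F D) x₀ 0) :
    ∃ κ : ℝ, 0 < κ ∧ ∀ᶠ p : V × W in 𝓝 (x₀, F x₀), ∀ l ∈ regularNormalCone D p.2,
      ‖l‖ ≤ κ * ‖gradT F p.1 l‖ := by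
  obtain ⟨κ, hκ, h⟩ := h.linearization hF
  refine ⟨κ, hκ, h.mono ?_⟩
  rintro ⟨x, y⟩ hxy l ⟨hy, hl⟩
  -- testing with `e = -l` gives `‖l‖² ≤ -⟨∇F(x)ᵀ l, w⟩ ≤ ‖∇F(x)ᵀ l‖ κ ‖l‖`
  obtain ⟨w, hw, hwT⟩ := hxy hy (-l)
  have h₁ := hl _ hwT
  rw [norm_neg] at hw
  rw [inner_sub_right, inner_neg_right, real_inner_self_eq_norm_sq, ← gradT_inner] at h₁
  have h₂ := abs_le.1 (abs_real_inner_le_norm (gradT F x l) w)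
  rcases eq_or_lt_of_le (norm_nonneg l) with h0 | h0
  · rw [← h0]; positivity
  · have h₃ : ‖l‖ * ‖l‖ ≤ (κ * ‖gradT F x l‖) * ‖l‖ := by
      nlinarith [norm_nonneg (gradT F x l)]
    exact le_of_mul_le_mul_right h₃ h0

/-- Limits of approximate multipliers that lie in the regular normal cone of `D` at points
arbitrarily close to `F(x₀)`: metric regularity keeps them bounded, so that a subsequence converges
to a multiplier at `x₀`. -/
theorem MetricallyRegularNear.exists_limit_multiplier {F : V → W} {D : Set W} {x₀ : V}
    (hF : ContDiff ℝ 1 F) (h : MetricallyRegularNear (constraintMap F D) x₀ 0)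
    {x : ℕ → V} (hx : Tendsto x atTop (𝓝 x₀)) {l : ℕ → W} {b : V}
    (hl : ∀ t, ∀ N ∈ 𝓝 (F x₀), ∃ y ∈ N, l t ∈ regularNormalCone D y)
    (hb : Tendsto (fun t => gradT F (x t) (l t)) atTop (𝓝 b)) :
    ∃ l₀ ∈ limitingNormalCone D (F x₀), gradT F x₀ l₀ = b ∧
      ∃ φ : ℕ → ℕ, StrictMono φ ∧ Tendsto (l ∘ φ) atTop (𝓝 l₀) := by
  obtain ⟨κ, hκ, hbd⟩ := h.norm_le (hF.differentiable one_ne_zero)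
  rw [nhds_prod_eq] at hbd
  obtain ⟨pa, hpa, pb, hpb, hpab⟩ := eventually_prod_iff.1 hbd
  obtain ⟨n₀, hn₀⟩ := eventually_atTop.1 (hx.eventually hpa)
  obtain ⟨M, hM⟩ := hb.norm.bddAbove_range
  have hbound : ∀ t, l (t + n₀) ∈ Metric.closedBall (0 : W) (κ * M) := fun t => by
    obtain ⟨y, hy, hly⟩ := hl (t + n₀) _ hpb
    have := hpab (hn₀ (t + n₀) (Nat.le_add_left _ _)) hy _ hly
    exact mem_closedBall_zero_iff.2 (this.trans (by gcongr; exact hM ⟨_, rfl⟩))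
  obtain ⟨l₀, -, φ, hφ, hφl⟩ := tendsto_subseq_of_bounded Metric.isBounded_closedBall hbound
  have hψ : StrictMono fun t => φ t + n₀ := fun a b hab => Nat.add_lt_add_right (hφ hab) _
  refine ⟨l₀, ?_, ?_, _, hψ, hφl⟩
  · have hex : ∀ t : ℕ, ∃ y ∈ Metric.ball (F x₀) (1 / ((t : ℝ) + 1)),
        l (φ t + n₀) ∈ regularNormalCone D y :=
      fun t => hl _ _ (Metric.ball_mem_nhds _ (by positivity))
    choose y hy hyl using hex
    refine ⟨y, fun t => l (φ t + n₀), ?_, hφl, hyl⟩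
    exact tendsto_iff_dist_tendsto_zero.2 (squeeze_zero (fun _ => dist_nonneg)
      (fun t => (Metric.mem_ball.1 (hy t)).le) tendsto_one_div_add_atTop_nhds_zero_nat)
  · have hg : Tendsto (fun t => gradT F (x (φ t + n₀))) atTop (𝓝 (gradT F x₀)) := by
      have hc : Continuous (gradT F) :=
        (ContinuousLinearMap.adjoint (𝕜 := ℝ) (E := V) (F := W)).continuous.comp
          (hF.continuous_fderiv one_ne_zero)
      exact (hc.tendsto x₀).comp (hx.comp hψ.tendsto_atTop)
    exact tendsto_nhds_unique
      ((isBoundedBilinearMap_apply.continuous.tendsto (gradT F x₀, l₀)).comp (hg.prodMk_nhds hφl))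
      (hb.comp hψ.tendsto_atTop)

/-- A Farkas type lemma. If `‖q‖ ≤ κ ‖G q‖` on the polar cone of `Q`, the image of this polar cone
under `G` is closed, hence it contains `b` unless a hyperplane separates them. -/
theorem exists_polarCone_map_eq {G : W →L[ℝ] V} {Q : Set W} {κ : ℝ} {b : V}
    (hbd : ∀ q ∈ polarCone Q, ‖q‖ ≤ κ * ‖G q‖)
    (h : ∀ u, (∀ q ∈ polarCone Q, ⟪q, ContinuousLinearMap.adjoint G u⟫ ≤ 0) → ⟪b, u⟫ ≤ 0) :
    ∃ q ∈ polarCone Q, G q = b := by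
  let C : ProperCone ℝ W :=
    { carrier := polarCone Q
      add_mem' := fun {x y} hx hy q hq => by
        rw [inner_add_left]; exact add_nonpos (hx q hq) (hy q hq)
      zero_mem' := fun q _ => by simp
      smul_mem' := fun c x hx q hq => by
        change ⟪(c : ℝ) • x, q⟫ ≤ 0
        rw [real_inner_smul_left]
        exact mul_nonpos_of_nonneg_of_nonpos c.2 (hx q hq)
      isClosed' := isClosed_polarCone Q }
  have hC : ∀ q, q ∈ C ↔ q ∈ polarCone Q := fun q => Iff.rfl
  have hb : b ∈ C.map G := by
    rw [ProperCone.relative_hyperplane_separation]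
    intro u hu
    have := h (-u) fun q hq => by
      have := ProperCone.mem_innerDual.1 hu ((hC q).2 hq)
      rw [map_neg, inner_neg_right]
      linarith
    rw [inner_neg_right] at this
    linarith
  have hcl : b ∈ closure (G '' polarCone Q) := by
    rw [ProperCone.mem_map] at hb
    exact hb
  obtain ⟨z, hz, hzb⟩ := mem_closure_iff_seq_limit.1 hcl
  choose q hq hqz using hz
  obtain ⟨M, hM⟩ := hzb.norm.bddAbove_range
  have hbound : ∀ t, q t ∈ Metric.closedBall (0 : W) (|κ| * M) := fun t => by
    have h₁ := hbd _ (hq t)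
    have h₂ : ‖G (q t)‖ ≤ M := by rw [hqz]; exact hM ⟨t, rfl⟩
    refine mem_closedBall_zero_iff.2 (h₁.trans ?_)
    exact mul_le_mul (le_abs_self κ) h₂ (norm_nonneg _) (abs_nonneg _)
  obtain ⟨q₀, -, φ, hφ, hφq⟩ := tendsto_subseq_of_bounded Metric.isBounded_closedBall hbound
  refine ⟨q₀, (isClosed_polarCone Q).mem_of_tendsto hφq (.of_forall fun t => hq _), ?_⟩
  refine tendsto_nhds_unique ((G.continuous.tendsto q₀).comp hφq) ?_
  exact (hzb.comp hφ.tendsto_atTop).congr fun t => (hqz _).symm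

end Stationarity

/-! ### Polyhedral pieces near a feasible point -/

namespace MPDC

variable {n mD : ℕ} (P : MPDC n mD)

theorem contDiff_Fall : ContDiff ℝ 1 P.Fall :=
  (contDiff_piLp 2).2 P.contDiff_F

theorem differentiable_Fall : Differentiable ℝ P.Fall :=
  P.contDiff_Fall.differentiable one_ne_zero

/-- The cone of all `v` satisfying the constraints of `D_i^j` which are active at `y`, made
homogeneous. It is the tangent cone to `D_i^j` at `y` if `y ∈ D_i^j`. -/
def activeCone {i : Fin mD} (y : P.Block i) (j : Fin (P.numPieces i)) : Set (P.Block i) :=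
  {v | ∀ s, P.b i j s ≤ ⟪P.a i j s, y⟫ → ⟪P.a i j s, v⟫ ≤ 0}

variable {P}

theorem isClosed_piece (i : Fin mD) (j : Fin (P.numPieces i)) : IsClosed (P.piece i j) := by
  have : P.piece i j = ⋂ s, {y | ⟪P.a i j s, y⟫ ≤ P.b i j s} := by
    ext; simp [piece]
  rw [this]
  exact isClosed_iInter fun s => isClosed_le (continuous_const.inner continuous_id) continuous_const

theorem isClosed_activeCone {i : Fin mD} (y : P.Block i) (j : Fin (P.numPieces i)) :
    IsClosed (P.activeCone y j) := by
  have : P.activeCone y j =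
      ⋂ s, ⋂ (_ : P.b i j s ≤ ⟪P.a i j s, y⟫), {v | ⟪P.a i j s, v⟫ ≤ 0} := by
    ext; simp [activeCone]
  rw [this]
  exact isClosed_iInter fun s => isClosed_iInter fun _ =>
    isClosed_le (continuous_const.inner continuous_id) continuous_const

theorem smul_mem_activeCone {i : Fin mD} {y : P.Block i} {j : Fin (P.numPieces i)}
    {v : P.Block i} (hv : v ∈ P.activeCone y j) {t : ℝ} (ht : 0 ≤ t) :
    t • v ∈ P.activeCone y j := fun s hs => by
  rw [real_inner_smul_right]
  exact mul_nonpos_of_nonneg_of_nonpos ht (hv s hs)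

theorem add_mem_activeCone {i : Fin mD} {y : P.Block i} {j : Fin (P.numPieces i)}
    {v w : P.Block i} (hv : v ∈ P.activeCone y j) (hw : w ∈ P.activeCone y j) :
    v + w ∈ P.activeCone y j := fun s hs => by
  rw [inner_add_right]
  exact add_nonpos (hv s hs) (hw s hs)

theorem sub_mem_activeCone {i : Fin mD} {y z : P.Block i} {j : Fin (P.numPieces i)}
    (hz : z ∈ P.piece i j) : z - y ∈ P.activeCone y j := fun s hs => by
  rw [inner_sub_right]
  linarith [hz s]

/-- Small steps from a point of a piece along its active cone stay in the piece. -/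
theorem eventually_add_smul_mem_piece {i : Fin mD} {y v : P.Block i} {j : Fin (P.numPieces i)}
    (hy : y ∈ P.piece i j) (hv : v ∈ P.activeCone y j) :
    ∀ᶠ t in 𝓝[>] (0 : ℝ), y + t • v ∈ P.piece i j := by
  refine eventually_all.2 fun s => ?_
  by_cases hs : P.b i j s ≤ ⟪P.a i j s, y⟫
  · filter_upwards [self_mem_nhdsWithin] with t ht
    rw [inner_add_right, real_inner_smul_right]
    have := mul_nonpos_of_nonneg_of_nonpos (le_of_lt ht) (hv s hs)
    linarith [hy s]
  · have hc : Continuous fun t : ℝ => ⟪P.a i j s, y + t • v⟫ :=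
      continuous_const.inner (by fun_prop)
    have := (hc.tendsto 0).eventually_lt_const (u := P.b i j s) (by simpa using hs)
    exact (this.filter_mono nhdsWithin_le_nhds).mono fun t ht => ht.le

/-- Only the pieces which contain `y` are met near `y`. -/
theorem eventually_mem_piece_imp {i : Fin mD} (y : P.Block i) :
    ∀ᶠ z in 𝓝 y, ∀ j, z ∈ P.piece i j → y ∈ P.piece i j := by
  refine eventually_all.2 fun j => ?_
  by_cases hy : y ∈ P.piece i j
  · exact .of_forall fun _ _ => hy
  · filter_upwards [(isClosed_piece i j).isOpen_compl.mem_nhds hy] with z hz hz'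
    exact absurd hz' hz

theorem branch_activeCone_subset_tangentCone {y : P.Img} {ν : P.Branch}
    (hν : ∀ i, ν i ∈ P.active y i) :
    branch (fun i => P.activeCone (y i)) ν ⊆ tangentCone (P.Dbranch ν) y := by
  intro p hp
  have hev : ∀ᶠ t in 𝓝[>] (0 : ℝ), y + t • p ∈ P.Dbranch ν :=
    eventually_all.2 fun i => eventually_add_smul_mem_piece (hν i) (hp i)
  have hseq : ∃ s : ℕ → ℝ, (∀ k, 0 < s k ∧ y + s k • p ∈ P.Dbranch ν) ∧
      Tendsto s atTop (𝓝 0) := by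
    obtain ⟨s, hs, hs'⟩ := exists_seq_forall_of_frequently
      (hev.and self_mem_nhdsWithin).frequently
    exact ⟨s, fun k => ⟨(hs' k).2, (hs' k).1⟩, hs.mono_right nhdsWithin_le_nhds⟩
  obtain ⟨s, hs, hs₀⟩ := hseq
  exact ⟨fun _ => p, s, tendsto_const_nhds, fun k => (hs k).1, hs₀, fun k => (hs k).2⟩

theorem tangentCone_Dbranch {y : P.Img} {ν : P.Branch} (hν : ∀ i, ν i ∈ P.active y i) :
    tangentCone (P.Dbranch ν) y = branch (fun i => P.activeCone (y i)) ν := by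
  refine Subset.antisymm ?_ (branch_activeCone_subset_tangentCone hν)
  rintro w ⟨ws, ts, hw, ht, -, hD⟩ i
  have hwi : Tendsto (fun k => ws k i) atTop (𝓝 (w i)) :=
    ((PiLp.continuous_apply 2 P.Block i).tendsto w).comp hw
  refine (isClosed_activeCone (y i) (ν i)).mem_of_tendsto hwi (.of_forall fun k => ?_)
  have h := smul_mem_activeCone (sub_mem_activeCone (y := y i) (hD k i))
    (inv_nonneg.2 (ht k).le)
  simpa [inv_smul_smul₀ (ht k).ne'] using h

theorem mem_disjSet_iff_exists_branch {C : ∀ i, Fin (P.numPieces i) → Set (P.Block i)}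
    {I : ∀ i, Set (Fin (P.numPieces i))} {y : P.Img} :
    y ∈ disjSet C I ↔ ∃ ν : P.Branch, (∀ i, ν i ∈ I i) ∧ y ∈ branch C ν := by
  constructor
  · intro h
    have : ∀ i, ∃ j, j ∈ I i ∧ y i ∈ C i j := fun i => by simpa using h i
    choose ν h₁ h₂ using this
    exact ⟨ν, h₁, h₂⟩
  · rintro ⟨ν, h₁, h₂⟩ i
    exact mem_biUnion (h₁ i) (h₂ i)

theorem disjSet_activeCone_subset_tangentCone (y : P.Img) :
    disjSet (fun i => P.activeCone (y i)) (P.active y) ⊆ tangentCone P.D y := by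
  intro p hp
  obtain ⟨ν, hν, hp⟩ := mem_disjSet_iff_exists_branch.1 hp
  refine tangentCone_mono ?_ y (branch_activeCone_subset_tangentCone hν hp)
  exact fun z hz => mem_disjSet_iff_exists_branch.2 ⟨ν, fun _ => mem_univ _, hz⟩

/-- Near `y`, the set `D` is the translate `y + T` of `T = T_D(y)`. Since `T` is a cone, its regular
normals at `p ∈ T` are therefore regular normals to `D` at `y + t p` for small `t > 0`. -/
theorem exists_mem_regularNormalCone_D {y p l : P.Img}
    (hp : p ∈ disjSet (fun i => P.activeCone (y i)) (P.active y))
    (hl : l ∈ polarCone (tangentCone (disjSet (fun i => P.activeCone (y i)) (P.active y)) p))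
    {N : Set P.Img} (hN : N ∈ 𝓝 y) : ∃ z ∈ N, l ∈ regularNormalCone P.D z := by
  have hloc : ∀ᶠ z in 𝓝 y, z ∈ P.D →
      z - y ∈ disjSet (fun i => P.activeCone (y i)) (P.active y) := by
    have : ∀ᶠ z in 𝓝 y, ∀ i j, z i ∈ P.piece i j → y i ∈ P.piece i j :=
      eventually_all.2 fun i =>
        ((PiLp.continuous_apply 2 P.Block i).tendsto y).eventually (eventually_mem_piece_imp (y i))
    filter_upwards [this] with z hz hzD
    obtain ⟨ν, -, hν⟩ := mem_disjSet_iff_exists_branch.1 hzD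
    exact mem_disjSet_iff_exists_branch.2
      ⟨ν, fun i => hz i _ (hν i), fun i => sub_mem_activeCone (hν i)⟩
  have hlim : Tendsto (fun t : ℝ => y + t • p) (𝓝[>] 0) (𝓝 y) := by
    have hc : Continuous fun t : ℝ => y + t • p := by fun_prop
    simpa using (hc.tendsto 0).mono_left (nhdsWithin_le_nhds (s := Ioi 0))
  have hD : ∀ᶠ t in 𝓝[>] (0 : ℝ), y + t • p ∈ P.D := by
    obtain ⟨ν, hν, hp⟩ := mem_disjSet_iff_exists_branch.1 hp
    have : ∀ᶠ t in 𝓝[>] (0 : ℝ), y + t • p ∈ P.Dbranch ν :=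
      eventually_all.2 fun i => eventually_add_smul_mem_piece (hν i) (hp i)
    exact this.mono fun t ht => mem_disjSet_iff_exists_branch.2 ⟨ν, fun _ => mem_univ _, ht⟩
  obtain ⟨t, htD, htN, htloc, ht⟩ := (hD.and ((hlim.eventually_mem hN).and
    ((hlim.eventually (eventually_eventually_nhds.2 hloc)).and self_mem_nhdsWithin))).exists
  have ht : 0 < t := ht
  refine ⟨_, htN, htD, fun w hw => hl w ?_⟩
  obtain ⟨ws, ts, hws, hts, hts₀, hmem⟩ := hw
  have hz : Tendsto (fun k => y + t • p + ts k • ws k) atTop (𝓝 (y + t • p)) := by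
    simpa using (hts₀.smul hws).const_add (y + t • p)
  obtain ⟨k₀, hk₀⟩ := eventually_atTop.1 (hz.eventually htloc)
  refine ⟨fun k => ws (k + k₀), fun k => t⁻¹ * ts (k + k₀),
    hws.comp (tendsto_add_atTop_nat k₀), fun k => mul_pos (inv_pos.2 ht) (hts _), ?_, fun k => ?_⟩
  · simpa using (hts₀.comp (tendsto_add_atTop_nat k₀)).const_mul t⁻¹
  · have h := hk₀ (k + k₀) (Nat.le_add_left _ _) (hmem _)
    obtain ⟨ν, hν, h⟩ := mem_disjSet_iff_exists_branch.1 h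
    refine mem_disjSet_iff_exists_branch.2 ⟨ν, hν, fun i => ?_⟩
    have h' := smul_mem_activeCone (h i) (inv_nonneg.2 ht.le)
    convert h' using 1
    simp only [PiLp.add_apply, PiLp.smul_apply, PiLp.sub_apply, mul_smul]
    rw [add_assoc, add_sub_cancel_left, smul_add, inv_smul_smul₀ ht.ne']

/-! ### Identification of the active index sets -/

theorem epsCone_eq_activeCone {x₀ x : EuclideanSpace ℝ (Fin n)} {ε : ℝ}
    (h : P.ExactIndexSets x₀ x ε) {i : Fin mD} {j : Fin (P.numPieces i)}
    (hj : j ∈ P.active (P.Fall x₀) i) : P.epsCone x ε i j = P.activeCone (P.Fall x₀ i) j := by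
  ext v
  change (∀ s ∈ P.epsIneq x ε i j, _) ↔ _
  rw [(h i).2 j hj]
  change (∀ s, P.b i j s - 0 ≤ _ → _) ↔ _
  simp only [sub_zero]
  rfl

theorem branch_epsCone_eq {x₀ x : EuclideanSpace ℝ (Fin n)} {ε : ℝ}
    (h : P.ExactIndexSets x₀ x ε) {ν : P.Branch} (hν : ∀ i, ν i ∈ P.active (P.Fall x₀) i) :
    branch (P.epsCone x ε) ν = tangentCone (P.Dbranch ν) (P.Fall x₀) := by
  rw [tangentCone_Dbranch hν]
  simp only [branch]
  congr 1
  funext i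
  exact epsCone_eq_activeCone h (hν i)

theorem disjSet_epsCone_eq {x₀ x : EuclideanSpace ℝ (Fin n)} {ε : ℝ}
    (h : P.ExactIndexSets x₀ x ε) : disjSet (P.epsCone x ε) (P.epsActive x ε) =
      disjSet (fun i => P.activeCone (P.Fall x₀ i)) (P.active (P.Fall x₀)) := by
  simp only [disjSet]
  congr 1
  funext i
  rw [(h i).1]
  exact iUnion₂_congr fun j hj => epsCone_eq_activeCone h hj

/-- The index sets are identified once `ε t` dominates `‖F(x t) - F(x₀)‖`, which is of the order of
`‖x t - x₀‖`, and is smaller than the slack of the inactive pieces and inequalities. -/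
theorem eventually_exactIndexSets {x₀ : EuclideanSpace ℝ (Fin n)}
    {x : ℕ → EuclideanSpace ℝ (Fin n)} {ε : ℕ → ℝ} (hx : Tendsto x atTop (𝓝 x₀))
    (hε_pos : ∀ t, 0 < ε t) (hε : Tendsto ε atTop (𝓝 0))
    (hrate : Tendsto (fun t => ‖x t - x₀‖ / ε t) atTop (𝓝 0)) :
    ∀ᶠ t in atTop, P.ExactIndexSets x₀ (x t) (ε t) := by
  refine eventually_all.2 fun i => ?_
  obtain ⟨L, U, hU, hL⟩ := (P.contDiff_F i).contDiffAt.exists_lipschitzOnWith (x := x₀)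
  have hF : Tendsto (fun t => P.F i (x t)) atTop (𝓝 (P.F i x₀)) :=
    ((P.contDiff_F i).continuous.tendsto x₀).comp hx
  have hclose : ∀ᶠ t in atTop, ‖P.F i (x t) - P.F i x₀‖ ≤ ε t := by
    have hL' : Tendsto (fun t => L * (‖x t - x₀‖ / ε t)) atTop (𝓝 0) := by
      simpa using hrate.const_mul (L : ℝ)
    filter_upwards [hx.eventually_mem hU, hL'.eventually_le_const one_pos] with t ht ht'
    refine (hL.norm_sub_le ht (mem_of_mem_nhds hU)).trans ?_
    rw [← mul_div_assoc, div_le_one (hε_pos t)] at ht'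
    exact ht'
  refine Eventually.and ?_ ?_
  · have hin : ∀ᶠ t in atTop, ∀ j, j ∈ P.epsActive (x t) (ε t) i → j ∈ P.active (P.Fall x₀) i := by
      refine eventually_all.2 fun j => ?_
      by_cases hj : j ∈ P.active (P.Fall x₀) i
      · exact .of_forall fun _ _ => hj
      · have hpos : 0 < Metric.infEDist (P.F i x₀) (P.piece i j) := by
          rw [pos_iff_ne_zero, Ne, ← Metric.mem_iff_infEDist_zero_of_closed (isClosed_piece i j)]
          exact hj
        have h₁ : Tendsto (fun t => Metric.infEDist (P.F i (x t)) (P.piece i j)) atTop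
            (𝓝 (Metric.infEDist (P.F i x₀) (P.piece i j))) :=
          (Metric.continuous_infEDist.tendsto _).comp hF
        have h₂ : Tendsto (fun t => ENNReal.ofReal (ε t)) atTop (𝓝 0) := by
          simpa using ENNReal.tendsto_ofReal hε
        filter_upwards [h₂.eventually_lt h₁ hpos] with t ht hjt
        exact absurd hjt (not_le.2 ht)
    filter_upwards [hin, hclose] with t ht htc
    refine Subset.antisymm (fun j hj => ht j hj) fun j hj => ?_
    have hj' : P.F i x₀ ∈ P.piece i j := hj
    refine (Metric.infEDist_le_edist_of_mem hj').trans ?_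
    rw [edist_dist, dist_eq_norm]
    exact ENNReal.ofReal_le_ofReal htc
  · refine eventually_all.2 fun j => eventually_imp_distrib_left.2 fun hj => ?_
    have hin : ∀ᶠ t in atTop, ∀ s, s ∈ P.epsIneq (x t) (ε t) i j → s ∈ P.epsIneq x₀ 0 i j := by
      refine eventually_all.2 fun s => ?_
      by_cases hs : s ∈ P.epsIneq x₀ 0 i j
      · exact .of_forall fun _ _ => hs
      · have h₁ : Tendsto (fun t => ⟪P.a i j s, P.F i (x t)⟫) atTop
            (𝓝 ⟪P.a i j s, P.F i x₀⟫) := tendsto_const_nhds.inner hF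
        have h₂ : Tendsto (fun t => P.b i j s - ε t) atTop (𝓝 (P.b i j s - 0)) :=
          hε.const_sub _
        filter_upwards [h₁.eventually_lt h₂ (not_le.1 hs)] with t ht hst
        exact absurd hst (not_le.2 ht)
    filter_upwards [hin, hclose] with t ht htc
    refine Subset.antisymm (fun s hs => ht s hs) fun s hs => ?_
    have h₁ : P.b i j s - 0 ≤ ⟪P.a i j s, P.F i x₀⟫ := hs
    have h₂ := (abs_le.1 (abs_real_inner_le_norm (P.a i j s) (P.F i (x t) - P.F i x₀))).1
    rw [P.norm_a, one_mul, inner_sub_right] at h₂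
    show P.b i j s - ε t ≤ ⟪P.a i j s, P.F i (x t)⟫
    linarith

end MPDC

/-! ### Outputs of the basic algorithm for the auxiliary program -/

section Product

variable {m : ℕ} {r : Fin m → ℕ} {Y : Fin m → Type*}
  [∀ i, NormedAddCommGroup (Y i)] [∀ i, InnerProductSpace ℝ (Y i)]

/-- The polar of a product of cones is contained in the product of the polars. -/
theorem inner_le_zero_of_mem_polarCone_branch {C : ∀ i, Fin (r i) → Set (Y i)} {ν : ∀ i, Fin (r i)}
    (h₀ : ∀ i, (0 : Y i) ∈ C i (ν i)) {l : PiLp 2 Y} (hl : l ∈ polarCone (branch C ν))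
    (i : Fin m) {c : Y i} (hc : c ∈ C i (ν i)) : ⟪l i, c⟫ ≤ 0 := by
  have h := hl (WithLp.toLp 2 (Pi.single i c)) fun i' => by
    rcases eq_or_ne i' i with rfl | hi
    · simpa using hc
    · simpa [hi] using h₀ i'
  rw [PiLp.inner_apply, Finset.sum_eq_single i] at h
  · simpa using h
  · intro i' _ hi
    simp [hi]
  · simp

/-- If `l` is polar to each of the cones `∏ᵢ C i (ν l i)` of a selected tuple and orthogonal to `p`,
it is a regular normal at `p` to the whole disjunctive set, since the tuple uses all pieces which
contribute to the tangent cone at `p`. -/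
theorem mem_polarCone_tangentCone_disjSet {C : ∀ i, Fin (r i) → Set (Y i)}
    {I J : ∀ i, Set (Fin (r i))} (h₀ : ∀ i j, (0 : Y i) ∈ C i j) {p l : PiLp 2 Y}
    (hJ : IsActiveChoice C I p J) {k : ℕ} {ν : Fin (k + 1) → ∀ i, Fin (r i)}
    (hν : IsBranchTuple J ν) (hl : ∀ s, l ∈ polarCone (branch C (ν s))) (hlp : ⟪l, p⟫ = 0) :
    l ∈ polarCone (tangentCone (disjSet C I) p) := by
  have hact : ∀ s i, ν s i ∈ I i ∧ p i ∈ C i (ν s i) := fun s i =>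
    (hJ i).1 (by rw [← hν i]; exact mem_range_self s)
  have hle : ∀ i, ⟪l i, p i⟫ ≤ 0 := fun i =>
    inner_le_zero_of_mem_polarCone_branch (fun _ => h₀ _ _) (hl 0) i (hact 0 i).2
  have hzero : ∀ i, ⟪l i, p i⟫ = 0 := fun i => by
    rw [PiLp.inner_apply] at hlp
    exact (Finset.sum_eq_zero_iff_of_nonpos fun i _ => hle i).1 hlp i (Finset.mem_univ i)
  rintro w ⟨ws, ts, hw, ht, ht₀, hmem⟩
  rw [PiLp.inner_apply]
  refine Finset.sum_nonpos fun i _ => ?_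
  have hwi : w i ∈ tangentCone (⋃ j ∈ I i, C i j) (p i) :=
    ⟨fun k => ws k i, ts, ((PiLp.continuous_apply 2 Y i).tendsto w).comp hw, ht, ht₀,
      fun k => hmem k i⟩
  rw [(hJ i).2] at hwi
  obtain ⟨j, hj, hwj⟩ := mem_iUnion₂.1 hwi
  rw [← hν i] at hj
  obtain ⟨s, rfl⟩ := hj
  obtain ⟨vs, τs, hv, hτ, -, hmem'⟩ := hwj
  refine le_of_tendsto' (tendsto_const_nhds.inner hv : Tendsto (fun k => ⟪l i, vs k⟫) _ _)
    fun k => ?_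
  have h := inner_le_zero_of_mem_polarCone_branch (fun _ => h₀ _ _) (hl s) i (hmem' k)
  rw [inner_add_right, hzero, zero_add, real_inner_smul_right] at h
  exact nonpos_of_mul_nonpos_right h (hτ k)

end Product

theorem nonneg_of_forall_small {a b : ℝ} (h : ∀ t : ℝ, 0 < t → t ≤ 1 → 0 ≤ t * a + t ^ 2 * b) :
    0 ≤ a := by
  have hlim : Tendsto (fun t : ℝ => a + t * b) (𝓝[>] 0) (𝓝 a) := by
    have hc : Continuous fun t : ℝ => a + t * b := by fun_prop
    simpa using (hc.tendsto 0).mono_left (nhdsWithin_le_nhds (s := Ioi 0))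
  refine ge_of_tendsto hlim ?_
  filter_upwards [Ioc_mem_nhdsGT (zero_lt_one (α := ℝ))] with t ht
  have := h t ht.1 ht.2
  refine nonneg_of_mul_nonneg_right (a := t) (b := a + t * b) ?_ ht.1
  linarith

namespace MPDC

variable {n mD : ℕ} {P : MPDC n mD}

theorem zero_mem_epsCone (x : EuclideanSpace ℝ (Fin n)) (ε : ℝ) (i : Fin mD)
    (j : Fin (P.numPieces i)) : (0 : P.Block i) ∈ P.epsCone x ε i j := fun s _ => by simp

theorem branch_epsCone_add {x : EuclideanSpace ℝ (Fin n)} {ε : ℝ} {ν : P.Branch} {p q : P.Img}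
    (hp : p ∈ branch (P.epsCone x ε) ν) (hq : q ∈ branch (P.epsCone x ε) ν) :
    p + q ∈ branch (P.epsCone x ε) ν := fun i s hs => by
  rw [PiLp.add_apply, inner_add_right]
  exact add_nonpos (hp i s hs) (hq i s hs)

theorem branch_epsCone_smul {x : EuclideanSpace ℝ (Fin n)} {ε : ℝ} {ν : P.Branch} {p : P.Img}
    (hp : p ∈ branch (P.epsCone x ε) ν) {t : ℝ} (ht : 0 ≤ t) :
    t • p ∈ branch (P.epsCone x ε) ν := fun i s hs => by
  rw [PiLp.smul_apply, real_inner_smul_right]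
  exact mul_nonpos_of_nonneg_of_nonpos ht (hp i s hs)

/-- The auxiliary objective is strictly convex, so that no branch program is unbounded and the basic
algorithm stops at a point which solves all selected branch programs. -/
theorem exists_selection_of_basicOutput {x : EuclideanSpace ℝ (Fin n)} {ε σ : ℝ} (hσ : 0 < σ)
    {z : P.UV} {nubar : P.Branch} (h : (P.auxQPDC x ε σ).BasicOutput z nubar) :
    ∃ (k : ℕ) (ν : Fin (k + 1) → P.Branch), (P.auxQPDC x ε σ).Selection z ν ∧ ν 0 = nubar ∧
      ∀ l, (P.auxQPDC x ε σ).SolvesBranch (ν l) z := by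
  cases h with
  | unbounded k ν l w _ _ hw =>
    exfalso
    obtain ⟨hB, -, hd⟩ := hw
    obtain ⟨⟨w₁, w₂⟩⟩ := w
    have hw₁ : w₁ = 0 := by
      have : σ • w₁ = 0 := congrArg (fun y : P.UV => y.fst) hB
      exact (smul_eq_zero.1 this).resolve_left hσ.ne'
    rw [auxQPDC, WithLp.prod_inner_apply] at hd
    simp [hw₁] at hd
  | stationary k ν s _ hν hs heq =>
    refine ⟨k, ν, hν, rfl, fun l => ⟨fun i => ?_, fun z' hz' => ?_⟩⟩
    · obtain ⟨J, hJ, hνJ⟩ := hν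
      exact ((hJ i).1 (by rw [← hνJ i]; exact mem_range_self l)).2
    · rw [heq l]
      exact (hs l).2 z' hz'

/-- First-order optimality for a branch program of the auxiliary program. -/
theorem solvesBranch_first_order {x : EuclideanSpace ℝ (Fin n)} {ε σ : ℝ} {ν : P.Branch}
    {u : EuclideanSpace ℝ (Fin n)} {v : P.Img}
    (h : (P.auxQPDC x ε σ).SolvesBranch ν (WithLp.toLp 2 (u, v)))
    {w : EuclideanSpace ℝ (Fin n)} {y : P.Img}
    (hwy : ∀ t : ℝ, 0 < t → t ≤ 1 → fderiv ℝ P.Fall x u + v + t • (fderiv ℝ P.Fall x w + y) ∈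
      branch (P.epsCone x ε) ν) :
    0 ≤ ⟪gradient P.f x, w⟫ + σ * ⟪u, w⟫ + ⟪v, y⟫ := by
  refine nonneg_of_forall_small (b := σ / 2 * ‖w‖ ^ 2 + 1 / 2 * ‖y‖ ^ 2) fun t ht ht' => ?_
  have hle := h.2 (WithLp.toLp 2 (u + t • w, v + t • y)) (by
    rw [auxQPDC_A]
    change _ ∈ branch (P.epsCone x ε) ν
    convert hwy t ht ht' using 1
    rw [map_add, map_smul, smul_add]
    abel)
  rw [auxQPDC_q, auxQPDC_q, norm_add_sq_real, norm_add_sq_real, inner_add_right] at hle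
  simp only [real_inner_smul_right, norm_smul, mul_pow, Real.norm_eq_abs, sq_abs] at hle
  nlinarith

/-- The optimality conditions satisfied by an output `(u, v)`, `ν̄` of the basic algorithm for the
auxiliary program: `-v` is a multiplier for the residual `-∇f(x) - σ u`, it is polar to the branch
`ν̄` and a regular normal to the constraint set at `∇F(x) u + v`. -/
theorem optimality_of_basicOutput {x : EuclideanSpace ℝ (Fin n)} {ε σ : ℝ} (hσ : 0 < σ)
    {u : EuclideanSpace ℝ (Fin n)} {v : P.Img} {nubar : P.Branch}
    (h : (P.auxQPDC x ε σ).BasicOutput (WithLp.toLp 2 (u, v)) nubar) :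
    (∀ i, nubar i ∈ P.epsActive x ε i) ∧
    fderiv ℝ P.Fall x u + v ∈ branch (P.epsCone x ε) nubar ∧
    ⟪gradient P.f x, u⟫ = -(σ * ‖u‖ ^ 2 + ‖v‖ ^ 2) ∧
    gradT P.Fall x (-v) = -gradient P.f x - σ • u ∧
    -v ∈ polarCone (branch (P.epsCone x ε) nubar) ∧
    -v ∈ polarCone (tangentCone (disjSet (P.epsCone x ε) (P.epsActive x ε))
      (fderiv ℝ P.Fall x u + v)) := by
  obtain ⟨k, ν, ⟨J, hJ, hν⟩, rfl, hsol⟩ := exists_selection_of_basicOutput hσ h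
  rw [auxQPDC_A] at hJ
  have hfeas : ∀ l, fderiv ℝ P.Fall x u + v ∈ branch (P.epsCone x ε) (ν l) := fun l => by
    have := (hsol l).1
    rwa [auxQPDC_A] at this
  have hself : ⟪gradient P.f x, u⟫ + σ * ‖u‖ ^ 2 + ‖v‖ ^ 2 = 0 := by
    -- moving along the ray through `(u, v)` in both directions stays in the cone
    have h₁ := solvesBranch_first_order (hsol 0) (w := u) (y := v) fun t ht _ =>
      branch_epsCone_add (hfeas 0) (branch_epsCone_smul (hfeas 0) ht.le)
    have h₂ := solvesBranch_first_order (hsol 0) (w := -u) (y := -v) fun t ht ht' => by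
      convert branch_epsCone_smul (hfeas 0) (sub_nonneg.2 ht') using 1
      rw [map_neg, ← neg_add, smul_neg, sub_smul, one_smul, sub_eq_add_neg]
    simp only [inner_neg_right, real_inner_self_eq_norm_sq] at h₁ h₂
    linarith
  have hgrad : gradT P.Fall x v = gradient P.f x + σ • u := by
    refine (ext_inner_right ℝ fun w => ?_)
    rw [gradT_inner, inner_add_left, real_inner_smul_left]
    -- the directions `(w, -∇F(x) w)` do not change the constraint
    have key : ∀ w, 0 ≤ ⟪gradient P.f x, w⟫ + σ * ⟪u, w⟫ - ⟪v, fderiv ℝ P.Fall x w⟫ := fun w => by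
      have := solvesBranch_first_order (hsol 0) (w := w) (y := -fderiv ℝ P.Fall x w)
        fun t _ _ => by simpa using hfeas 0
      rw [inner_neg_right] at this
      linarith
    have h₁ := key w
    have h₂ := key (-w)
    simp only [map_neg, inner_neg_right] at h₂
    linarith
  have hpol : ∀ l, -v ∈ polarCone (branch (P.epsCone x ε) (ν l)) := fun l y hy => by
    have := solvesBranch_first_order (hsol l) (w := 0) (y := y) fun t ht _ => by
      rw [map_zero, zero_add]
      exact branch_epsCone_add (hfeas l) (branch_epsCone_smul hy ht.le)
    rw [inner_neg_left]
    simpa using this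
  refine ⟨fun i => ((hJ i).1 (by rw [← hν i]; exact mem_range_self 0)).1, hfeas 0, by linarith,
    by rw [map_neg, hgrad]; abel, hpol 0,
    mem_polarCone_tangentCone_disjSet (zero_mem_epsCone x ε) hJ hν hpol ?_⟩
  rw [inner_neg_left, inner_add_right, ← gradT_inner, hgrad, inner_add_left, real_inner_smul_left,
    real_inner_self_eq_norm_sq, real_inner_self_eq_norm_sq, hself, neg_zero]

end MPDC

/-! ### The tests of the checking algorithm near a B-stationary point -/

section Rates

variable {V W : Type*} [NormedAddCommGroup V] [InnerProductSpace ℝ V] [FiniteDimensional ℝ V]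
  [NormedAddCommGroup W] [InnerProductSpace ℝ W]

/-- From `σ a² + b² ≤ c (b + δ a)` one gets `σ a² ≤ c² / 4 + c δ a`, which excludes `σ a > η` when
`σ` is small compared to `η²` and `δ` is small compared to `η`. -/
theorem eventually_mul_le_of_rate {c : ℝ} (hc : 0 < c) {σ η δ : ℕ → ℝ} (hσ : ∀ t, 0 < σ t)
    (hη : ∀ t, 0 < η t) (hδ : ∀ t, 0 ≤ δ t)
    (hrate : Tendsto (fun t => (σ t / η t + δ t) / η t) atTop (𝓝 0)) :
    ∀ᶠ t in atTop, ∀ a b : ℝ, 0 ≤ a → σ t * a ^ 2 + b ^ 2 ≤ c * (b + δ t * a) →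
      σ t * a ≤ η t := by
  have hd : 0 < c ^ 2 + c + 1 := by positivity
  filter_upwards [hrate.eventually_le_const (inv_pos.2 hd)] with t ht a b ha hab
  have hσt := hσ t
  have hηt := hη t
  have hδt := hδ t
  set κ := (c ^ 2 + c + 1)⁻¹ with hκ
  have hκ₀ : 0 < κ := inv_pos.2 hd
  have hκ₁ : κ * (c ^ 2 + c + 1) = 1 := inv_mul_cancel₀ hd.ne'
  rw [div_le_iff₀ hηt] at ht
  have hσ' : σ t ≤ κ * η t ^ 2 := by
    have : σ t / η t ≤ κ * η t := by linarith
    rw [div_le_iff₀ hηt] at this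
    linarith
  have hδ' : δ t ≤ κ * η t := by
    have : 0 ≤ σ t / η t := by positivity
    linarith
  by_contra! hlt
  set A := σ t * a with hA
  have hA₀ : 0 < A := hηt.trans hlt
  have h₁ : σ t * a ^ 2 ≤ c ^ 2 / 4 + c * (δ t * a) := by nlinarith [sq_nonneg (b - c / 2)]
  have h₂ : A ^ 2 ≤ σ t * (c ^ 2 / 4) + c * δ t * A := by
    have := mul_le_mul_of_nonneg_left h₁ hσt.le
    rw [hA]
    nlinarith
  have h₃ : σ t * (c ^ 2 / 4) ≤ κ * c ^ 2 * A ^ 2 / 4 := by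
    have : η t ^ 2 ≤ A ^ 2 := by gcongr
    have : σ t ≤ κ * A ^ 2 := hσ'.trans (by gcongr)
    nlinarith [sq_nonneg c]
  have h₄ : c * δ t * A ≤ κ * c * A ^ 2 := by
    have : δ t ≤ κ * A := hδ'.trans (by gcongr)
    have := mul_le_mul_of_nonneg_left this (mul_pos hc hA₀).le
    linarith
  have h₅ : κ * c ^ 2 * A ^ 2 / 4 + κ * c * A ^ 2 < A ^ 2 := by
    have hA₂ : 0 < κ * A ^ 2 := by positivity
    have : κ * A ^ 2 * (c ^ 2 + c + 1) = A ^ 2 := by linear_combination A ^ 2 * hκ₁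
    nlinarith [mul_nonneg hA₂.le (sq_nonneg c)]
  linarith

variable {f : V → ℝ} {F : V → W} {D : Set W} {x₀ : V} {x : ℕ → V} {σ η : ℕ → ℝ}

/-- Near a B-stationary point, every solution of the auxiliary program passes the first test
`σ ‖u‖ ≤ η`. Of being a solution, only the value of `⟨∇f(x), u⟩` is needed. -/
theorem BStationary.eventually_mul_norm_le (hF : Differentiable ℝ F)
    (hLip : ∃ U ∈ 𝓝 x₀, ∃ L : NNReal,
      LipschitzOnWith L (gradient f) U ∧ LipschitzOnWith L (fderiv ℝ F) U)
    (hsub : MetricallySubregularAt (constraintMap F D) x₀ 0) (hB : BStationary f F D x₀)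
    (hx : Tendsto x atTop (𝓝 x₀)) (hσ : ∀ t, 0 < σ t) (hη : ∀ t, 0 < η t)
    (hrate : Tendsto (fun t => (σ t / η t + ‖x t - x₀‖) / η t) atTop (𝓝 0)) :
    ∀ᶠ t in atTop, ∀ u v, fderiv ℝ F (x t) u + v ∈ tangentCone D (F x₀) →
      ⟪gradient f (x t), u⟫ = -(σ t * ‖u‖ ^ 2 + ‖v‖ ^ 2) → σ t * ‖u‖ ≤ η t := by
  obtain ⟨c, hc, h⟩ := hB.eventually_le_inner_gradient hF hLip hsub
  filter_upwards [hx.eventually h, eventually_mul_le_of_rate hc hσ hη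
    (fun t => norm_nonneg (x t - x₀)) hrate] with t ht hrt u v huv hval
  refine hrt _ ‖v‖ (norm_nonneg u) ?_
  have := ht u v huv
  linarith

/-- Near a B-stationary point, directions in a fixed ball which are feasible for the linearized
program pass the second test `⟨∇f(x), u⟩ ≥ -η`. -/
theorem BStationary.eventually_neg_le_inner (hF : Differentiable ℝ F)
    (hLip : ∃ U ∈ 𝓝 x₀, ∃ L : NNReal,
      LipschitzOnWith L (gradient f) U ∧ LipschitzOnWith L (fderiv ℝ F) U)
    (hsub : MetricallySubregularAt (constraintMap F D) x₀ 0) (hB : BStationary f F D x₀)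
    (hx : Tendsto x atTop (𝓝 x₀)) (hσ : ∀ t, 0 < σ t) (hη : ∀ t, 0 < η t)
    (hrate : Tendsto (fun t => (σ t / η t + ‖x t - x₀‖) / η t) atTop (𝓝 0)) (R : ℝ) :
    ∀ᶠ t in atTop, ∀ u, fderiv ℝ F (x t) u ∈ tangentCone D (F x₀) → ‖u‖ ≤ R →
      -η t ≤ ⟪gradient f (x t), u⟫ := by
  obtain ⟨c, hc, h⟩ := hB.eventually_le_inner_gradient hF hLip hsub
  have hpos : 0 < (c * (|R| + 1))⁻¹ := by positivity
  filter_upwards [hx.eventually h, hrate.eventually_le_const hpos] with t ht hrt u hu huR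
  have hηt := hη t
  have h₁ := ht u 0 (by simpa using hu)
  rw [norm_zero, zero_add] at h₁
  rw [div_le_iff₀ hηt] at hrt
  have h₂ : ‖x t - x₀‖ ≤ (c * (|R| + 1))⁻¹ * η t := by
    have := div_pos (hσ t) hηt
    linarith
  have h₃ : ‖u‖ ≤ |R| + 1 := by linarith [le_abs_self R]
  have h₄ : c * (‖x t - x₀‖ * ‖u‖) ≤ c * ((c * (|R| + 1))⁻¹ * η t * (|R| + 1)) := by gcongr
  have h₅ : c * ((c * (|R| + 1))⁻¹ * η t * (|R| + 1)) = η t := by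
    have : |R| + 1 ≠ 0 := by positivity
    field_simp
  linarith

theorem continuous_gradient (hf : ContDiff ℝ 1 f) : Continuous (gradient f) :=
  (InnerProductSpace.toDual ℝ V).symm.continuous.comp (hf.continuous_fderiv one_ne_zero)

/-- Metric regularity allows to correct a direction `u` with `∇F(x₀) u ∈ T_D(F(x₀))` to directions
`u t → u` with `∇F(x t) (u t) ∈ T_D(F(x₀))`, so that approximate optimality of the zero direction for
the linearized programs at `x t` becomes exact in the limit. -/
theorem MetricallyRegularNear.inner_gradient_nonneg (hF : ContDiff ℝ 1 F) (hf : ContDiff ℝ 1 f)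
    (h : MetricallyRegularNear (constraintMap F D) x₀ 0) (hD : F x₀ ∈ D)
    (hadd : ∀ p ∈ tangentCone D (F x₀), ∀ q ∈ tangentCone D (F x₀),
      p + q ∈ tangentCone D (F x₀))
    (hsmul : ∀ p ∈ tangentCone D (F x₀), ∀ s : ℝ, 0 ≤ s → s • p ∈ tangentCone D (F x₀))
    (hx : Tendsto x atTop (𝓝 x₀)) (hη : Tendsto η atTop (𝓝 0))
    (htest : ∀ t, ∀ u, fderiv ℝ F (x t) u ∈ tangentCone D (F x₀) → ‖u‖ ≤ 1 →
      -η t ≤ ⟪gradient f (x t), u⟫) {u : V} (hu : fderiv ℝ F x₀ u ∈ tangentCone D (F x₀)) :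
    0 ≤ ⟪gradient f x₀, u⟫ := by
  -- the direction is scaled into the open unit ball to leave room for the correction
  set s : ℝ := (2 * (‖u‖ + 1))⁻¹ with hs
  have hs₀ : 0 < s := by positivity
  have hsu : ‖s • u‖ < 1 := by
    rw [norm_smul, Real.norm_of_nonneg hs₀.le, hs, inv_mul_lt_iff₀ (by positivity)]
    linarith [norm_nonneg u]
  obtain ⟨κ, hκ, hlin⟩ := h.linearization (hF.differentiable one_ne_zero)
  have hprod : Tendsto (fun t => (x t, F x₀)) atTop (𝓝 (x₀, F x₀)) :=
    hx.prodMk_nhds tendsto_const_nhds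
  obtain ⟨n₀, hn₀⟩ := eventually_atTop.1 (hprod.eventually hlin)
  let e : ℕ → W := fun t => -((fderiv ℝ F (x (t + n₀)) - fderiv ℝ F x₀) (s • u))
  choose w hw hwT using fun t : ℕ => hn₀ (t + n₀) (Nat.le_add_left _ _) hD (e t)
  have hx' : Tendsto (fun t => x (t + n₀)) atTop (𝓝 x₀) := hx.comp (tendsto_add_atTop_nat n₀)
  have he : Tendsto e atTop (𝓝 0) := by
    have h₁ : Continuous fun z => -((fderiv ℝ F z - fderiv ℝ F x₀) (s • u)) :=
      (((hF.continuous_fderiv one_ne_zero).sub continuous_const).clm_apply continuous_const).neg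
    have h₂ := (h₁.tendsto x₀).comp hx'
    simp only [sub_self, zero_apply, neg_zero] at h₂
    exact h₂
  have hw₀ : Tendsto w atTop (𝓝 0) := by
    refine squeeze_zero_norm hw ?_
    simpa using he.norm.const_mul κ
  have hu' : Tendsto (fun t => s • u + w t) atTop (𝓝 (s • u)) := by
    simpa using hw₀.const_add (s • u)
  have hle : ∀ᶠ t in atTop, -η (t + n₀) ≤ ⟪gradient f (x (t + n₀)), s • u + w t⟫ := by
    filter_upwards [hu'.norm.eventually_lt_const hsu] with t ht
    refine htest _ _ ?_ ht.le
    have := hadd _ (hsmul _ hu s hs₀.le) _ (hwT t)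
    convert this using 1
    simp only [e, map_add, sub_apply, map_smul]
    module
  have hlim : Tendsto (fun t => ⟪gradient f (x (t + n₀)), s • u + w t⟫) atTop
      (𝓝 ⟪gradient f x₀, s • u⟫) :=
    (((continuous_gradient hf).tendsto x₀).comp hx').inner hu'
  have h₀ := le_of_tendsto_of_tendsto (hη.comp (tendsto_add_atTop_nat n₀)).neg hlim hle
  rw [neg_zero, real_inner_smul_right] at h₀
  exact nonneg_of_mul_nonneg_right h₀ hs₀

end Rates

/-! ### Limits of accepted points -/

namespace MPDC

variable {n mD : ℕ} {P : MPDC n mD} {x₀ : EuclideanSpace ℝ (Fin n)}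

theorem norm_le_sqrt_of_box {u : EuclideanSpace ℝ (Fin n)} (hu : ∀ i, -1 ≤ u i ∧ u i ≤ 1) :
    ‖u‖ ≤ Real.sqrt n := by
  rw [EuclideanSpace.norm_eq]
  refine Real.sqrt_le_sqrt ?_
  calc ∑ i, ‖u i‖ ^ 2 ≤ ∑ _i : Fin n, (1 : ℝ) := by
        refine Finset.sum_le_sum fun i _ => ?_
        rw [Real.norm_eq_abs, sq_abs, sq_le_one_iff_abs_le_one]
        exact abs_le.2 (hu i)
    _ = n := by simp

theorem box_of_norm_le_one {u : EuclideanSpace ℝ (Fin n)} (hu : ‖u‖ ≤ 1) (i : Fin n) :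
    -1 ≤ u i ∧ u i ≤ 1 :=
  abs_le.1 ((PiLp.norm_apply_le u i).trans hu)

/-- Multipliers furnished by the basic algorithm at accepted points converge along a subsequence to
an M-multiplier of the limit point. -/
theorem exists_limit_multiplier_of_basicOutput
    (hreg : MetricallyRegularNear (constraintMap P.Fall P.D) x₀ 0)
    {x : ℕ → EuclideanSpace ℝ (Fin n)} {ε σ η : ℕ → ℝ} (hx : Tendsto x atTop (𝓝 x₀))
    (hσ_pos : ∀ t, 0 < σ t) (hη : Tendsto η atTop (𝓝 0)) {u : ℕ → EuclideanSpace ℝ (Fin n)}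
    {v : ℕ → P.Img} {nubar : ℕ → P.Branch} (hexact : ∀ t, P.ExactIndexSets x₀ (x t) (ε t))
    (hout : ∀ t, (P.auxQPDC (x t) (ε t) (σ t)).BasicOutput (WithLp.toLp 2 (u t, v t)) (nubar t))
    (hacc : ∀ t, σ t * ‖u t‖ ≤ η t) :
    ∃ l₀ ∈ limitingNormalCone P.D (P.Fall x₀), gradT P.Fall x₀ l₀ = -gradient P.f x₀ ∧
      ∃ φ : ℕ → ℕ, StrictMono φ ∧ Tendsto (fun t => -v (φ t)) atTop (𝓝 l₀) := by
  refine hreg.exists_limit_multiplier (l := fun t => -v t) P.contDiff_Fall hx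
    (fun t N hN => ?_) ?_
  · obtain ⟨hact, hfeas, -, -, -, hpol⟩ := optimality_of_basicOutput (hσ_pos t) (hout t)
    have hp := mem_disjSet_iff_exists_branch.2 ⟨nubar t, hact, hfeas⟩
    rw [disjSet_epsCone_eq (hexact t)] at hp hpol
    exact exists_mem_regularNormalCone_D hp hpol hN
  · have hσu : Tendsto (fun t => σ t • u t) atTop (𝓝 0) := by
      refine squeeze_zero_norm (fun t => ?_) hη
      rw [norm_smul, Real.norm_of_nonneg (hσ_pos t).le]
      exact hacc t
    have hg := ((continuous_gradient P.contDiff_f).tendsto x₀).comp hx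
    have := hg.neg.sub hσu
    rw [sub_zero] at this
    exact this.congr fun t => ((optimality_of_basicOutput (hσ_pos t) (hout t)).2.2.2.1).symm

/-- The bipolar theorem for the tangent cone to a branch. The normals `a i j s` of the active
constraints, placed in the block `i`, lie in the polar cone, so no separation is needed. -/
theorem mem_tangentCone_Dbranch_of_polar {y : P.Img} {ν : P.Branch}
    (hν : ∀ i, ν i ∈ P.active y i) {p : P.Img}
    (hp : ∀ q ∈ polarCone (tangentCone (P.Dbranch ν) y), ⟪q, p⟫ ≤ 0) :
    p ∈ tangentCone (P.Dbranch ν) y := by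
  have hinner : ∀ (i : Fin mD) (c : P.Block i) (z : P.Img),
      ⟪(WithLp.toLp 2 (Pi.single i c) : P.Img), z⟫ = ⟪c, z i⟫ := fun i c z => by
    rw [PiLp.inner_apply, Finset.sum_eq_single i]
    · simp
    · intro i' _ hi
      simp [hi]
    · simp
  rw [tangentCone_Dbranch hν] at hp ⊢
  intro i s hs
  rw [← hinner]
  exact hp _ fun z hz => by
    rw [hinner]
    exact hz i s hs

/-- Passing to the limit in the branch tests at `x t` yields a multiplier in the polar of the
tangent cone to a metrically regular branch. -/
theorem exists_branch_multiplier {ν : P.Branch} (hν : ∀ i, ν i ∈ P.active (P.Fall x₀) i)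
    (hreg : MetricallyRegularNear (constraintMap P.Fall (P.Dbranch ν)) x₀ 0)
    {x : ℕ → EuclideanSpace ℝ (Fin n)} {ε η : ℕ → ℝ} (hx : Tendsto x atTop (𝓝 x₀))
    (hη : Tendsto η atTop (𝓝 0)) (hexact : ∀ t, P.ExactIndexSets x₀ (x t) (ε t))
    (htest : ∀ t, P.LPTest (x t) (ε t) (η t) ν) :
    ∃ q ∈ polarCone (tangentCone (P.Dbranch ν) (P.Fall x₀)),
      gradT P.Fall x₀ q = -gradient P.f x₀ := by
  have hmem : P.Fall x₀ ∈ P.Dbranch ν := fun i => hν i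
  obtain ⟨κ, -, hκ⟩ := hreg.norm_le P.differentiable_Fall
  refine exists_polarCone_map_eq (κ := κ) (fun q hq => hκ.self_of_nhds q ⟨hmem, hq⟩)
    fun u hu => ?_
  rw [gradT, ContinuousLinearMap.adjoint_adjoint] at hu
  have hu' := mem_tangentCone_Dbranch_of_polar hν hu
  have h := hreg.inner_gradient_nonneg P.contDiff_Fall P.contDiff_f hmem
    (fun p hp q hq => by
      rw [tangentCone_Dbranch hν] at hp hq ⊢
      exact fun i => add_mem_activeCone (hp i) (hq i))
    (fun p hp s hs => by
      rw [tangentCone_Dbranch hν] at hp ⊢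
      exact fun i => smul_mem_activeCone (hp i) hs)
    hx hη (fun t w hw hw₁ => htest t w (by rwa [branch_epsCone_eq (hexact t) hν])
      (box_of_norm_le_one hw₁)) hu'
  rw [inner_neg_left]
  linarith

end MPDC

end DisjProg

/-! ### Asymptotic correctness of the checking algorithm -/

theorem mainTheorem6 {n mD : ℕ} (P : DisjProg.MPDC n mD) (x₀ : EuclideanSpace ℝ (Fin n))
    (hx₀ : P.Fall x₀ ∈ P.D)
    (hLip : ∃ U ∈ 𝓝 x₀, ∃ L : NNReal,
      LipschitzOnWith L (gradient P.f) U ∧ LipschitzOnWith L (fderiv ℝ P.Fall) U)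
    (J : ∀ i, Set (Fin (P.numPieces i))) (hJ : P.IsIndexChoice (P.Fall x₀) J)
    (x : ℕ → EuclideanSpace ℝ (Fin n)) (ε σ η : ℕ → ℝ)
    (hx : Tendsto x atTop (𝓝 x₀))
    (hε_pos : ∀ t, 0 < ε t) (hσ_pos : ∀ t, 0 < σ t) (hη_pos : ∀ t, 0 < η t)
    (hε : Tendsto ε atTop (𝓝 0)) (hσ : Tendsto σ atTop (𝓝 0)) (hη : Tendsto η atTop (𝓝 0))
    (hrate₁ : Tendsto (fun t => ‖x t - x₀‖ / ε t) atTop (𝓝 0))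
    (hrate₂ : Tendsto (fun t => (σ t / η t + ‖x t - x₀‖) / η t) atTop (𝓝 0))
    (out : ℕ → P.CheckOutput)
    (hout : ∀ t, (∀ i, (P.epsActive (x t) (ε t) i).Nonempty) →
      P.IsCheckOutput (x t) (ε t) (σ t) (η t) (out t))
    (hcons : ∀ t, P.ExactIndexSets x₀ (x t) (ε t) → P.Consistent J (out t)) :
    (∀ᶠ t in atTop, P.ExactIndexSets x₀ (x t) (ε t)) ∧
    (DisjProg.MetricallyRegularNear (DisjProg.constraintMap P.Fall P.D) x₀ 0 →
      (DisjProg.BStationary P.f P.Fall P.D x₀ →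
        ∀ᶠ t in atTop, (out t).AcceptedM ∧ (out t).AcceptedQM) ∧
      ((∃ᶠ t in atTop, (out t).AcceptedM) → DisjProg.MStationary P.f P.Fall P.D x₀) ∧
      ((∃ᶠ t in atTop, (out t).AcceptedQM ∧ (out t).nubar ∈ P.regBranches J x₀ ∧
          ∀ (k : ℕ) (ν : Fin k → P.Branch), (out t).Computed ν → ∀ l, ν l ∈ P.regBranches J x₀) →
        P.QMStationary J x₀) ∧
      (∀ᶠ t in atTop, ¬ (out t).AcceptedM → (out t).nubar ∈ P.subregBranches J x₀ →
        ∃ z, P.Fall z ∈ P.Dbranch (out t).nubar ∧ P.f z < P.f x₀) ∧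
      (∀ᶠ t in atTop, ∀ (k : ℕ) (ν : Fin k → P.Branch) (l : Fin k),
        (out t).verdict = .rejectQM k ν l → ν l ∈ P.subregBranches J x₀ →
        ∃ z, P.Fall z ∈ P.Dbranch (ν l) ∧ P.f z < P.f x₀)) := by
  have hexact : ∀ᶠ t in atTop, P.ExactIndexSets x₀ (x t) (ε t) :=
    DisjProg.MPDC.eventually_exactIndexSets hx hε_pos hε hrate₁
  refine ⟨hexact, fun hreg => ?_⟩
  have hJA : ∀ i, J i ⊆ P.active (P.Fall x₀) i := fun i j hj => ((hJ i).1 hj).2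
  have hFd := P.differentiable_Fall
  have hfd := P.contDiff_f.differentiable one_ne_zero
  have hne : ∀ i, (P.active (P.Fall x₀) i).Nonempty := fun i => by
    obtain ⟨ν, -, hν⟩ := DisjProg.MPDC.mem_disjSet_iff_exists_branch.1 hx₀
    exact ⟨ν i, hν i⟩
  have hgood : ∀ᶠ t in atTop, P.ExactIndexSets x₀ (x t) (ε t) ∧
      P.IsCheckOutput (x t) (ε t) (σ t) (η t) (out t) ∧ P.Consistent J (out t) :=
    hexact.mono fun t ht => ⟨ht, hout t fun i => by rw [(ht i).1]; exact hne i, hcons t ht⟩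
  have hacc : ∀ t, P.IsCheckOutput (x t) (ε t) (σ t) (η t) (out t) → (out t).AcceptedM →
      σ t * ‖(out t).u‖ ≤ η t := fun t ht hM => by
    have h := ht.2.2
    unfold DisjProg.MPDC.CheckOutput.AcceptedM at hM
    split at h
    · exact absurd ‹_› hM
    · exact h.1
    · exact h.1
  have hrej : ∀ t, P.IsCheckOutput (x t) (ε t) (σ t) (η t) (out t) → ¬ (out t).AcceptedM →
      η t < σ t * ‖(out t).u‖ := fun t ht hM => by
    have h := ht.2.2
    rw [not_not.1 hM] at h
    exact h
  refine ⟨fun hB => ?_, fun hfr => ?_, fun hfr => ?_, ?_, ?_⟩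
  · have hsub := hreg.metricallySubregularAt
    filter_upwards [hgood, hB.eventually_mul_norm_le hFd hLip hsub hx hσ_pos hη_pos hrate₂,
      hB.eventually_neg_le_inner hFd hLip hsub hx hσ_pos hη_pos hrate₂ (Real.sqrt n)]
      with t ⟨hex, hchk, _⟩ h₁ h₂
    have hM : (out t).AcceptedM := by
      by_contra hM
      obtain ⟨hact, hfeas, hval, -⟩ :=
        DisjProg.MPDC.optimality_of_basicOutput (hσ_pos t) hchk.2.1
      have hp := DisjProg.MPDC.mem_disjSet_iff_exists_branch.2 ⟨_, hact, hfeas⟩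
      rw [DisjProg.MPDC.disjSet_epsCone_eq hex] at hp
      have := h₁ _ _ (DisjProg.MPDC.disjSet_activeCone_subset_tangentCone _ hp) hval
      exact absurd (hrej t hchk hM) (not_lt.2 this)
    refine ⟨hM, ?_⟩
    have h := hchk.2.2
    rcases hv : (out t).verdict with - | ⟨k, ν⟩ | ⟨k, ν, l⟩
    · exact absurd hv hM
    · exact ⟨k, ν, hv⟩
    · rw [hv] at h
      refine absurd (fun u hu hbox => ?_) h.2.2
      refine h₂ u (DisjProg.MPDC.disjSet_activeCone_subset_tangentCone _ ?_)
        (DisjProg.MPDC.norm_le_sqrt_of_box hbox)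
      rw [← DisjProg.MPDC.disjSet_epsCone_eq hex]
      exact DisjProg.MPDC.mem_disjSet_iff_exists_branch.2 ⟨ν l, h.2.1.1 l, hu⟩
  · obtain ⟨φ, hφ, hφP⟩ := extraction_of_frequently_atTop (hfr.and_eventually hgood)
    obtain ⟨l₀, hl₀, hgrad, -⟩ := DisjProg.MPDC.exists_limit_multiplier_of_basicOutput hreg
      (hx.comp hφ.tendsto_atTop) (fun t => hσ_pos (φ t)) (hη.comp hφ.tendsto_atTop)
      (fun t => (hφP t).2.1) (fun t => (hφP t).2.2.1.2.1)
      (fun t => hacc _ (hφP t).2.2.1 (hφP t).1)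
    exact ⟨l₀, hl₀, hgrad⟩
  · -- The number `K` of branches may vary with `t`, but there are only finitely many possibilities
    -- for `ν̄` and for the set of the computed branches: both may be assumed to be constant.
    have hfr' : ∃ᶠ t in atTop, ∃ c : P.Branch × Set P.Branch,
        ((out t).nubar = c.1 ∧ ∃ (k : ℕ) (ν : Fin k → P.Branch),
          (out t).verdict = .acceptQM k ν ∧ range ν = c.2) ∧
        ∀ ν ∈ c.2, ν ∈ P.regBranches J x₀ := by
      refine hfr.mono ?_
      rintro t ⟨⟨k, ν, hν⟩, -, hregν⟩
      refine ⟨((out t).nubar, range ν), ⟨rfl, k, ν, hν, rfl⟩, ?_⟩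
      rintro _ ⟨l, rfl⟩
      exact hregν k ν (Or.inl hν) l
    obtain ⟨⟨nb, S⟩, hc⟩ := frequently_exists.1 hfr'
    obtain ⟨φ, hφ, hφP⟩ := extraction_of_frequently_atTop (hc.and_eventually hgood)
    have hxφ := hx.comp hφ.tendsto_atTop
    have hηφ := hη.comp hφ.tendsto_atTop
    obtain ⟨l₀, hl₀, hgrad, ψ, -, hψl⟩ :=
      DisjProg.MPDC.exists_limit_multiplier_of_basicOutput hreg hxφ (fun t => hσ_pos (φ t)) hηφ
        (fun t => (hφP t).2.1) (fun t => (hφP t).2.2.1.2.1)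
        (fun t => hacc _ (hφP t).2.2.1 fun h => by
          obtain ⟨k, ν, hν, -⟩ := (hφP t).1.1.2
          rw [h] at hν
          exact absurd hν (by simp))
    have hnbA : ∀ i, nb i ∈ P.active (P.Fall x₀) i := fun i => by
      have := (hφP 0).2.2.2.1 i
      rw [(hφP 0).1.1.1] at this
      exact hJA i this
    have hl₀pol : l₀ ∈ DisjProg.polarCone
        (DisjProg.tangentCone (P.Dbranch nb) (P.Fall x₀)) := by
      refine (DisjProg.isClosed_polarCone _).mem_of_tendsto hψl (.of_forall fun t => ?_)
      have h := (DisjProg.MPDC.optimality_of_basicOutput (hσ_pos _) (hφP (ψ t)).2.2.1.2.1).2.2.2.2.1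
      rwa [(hφP (ψ t)).1.1.1, DisjProg.MPDC.branch_epsCone_eq (hφP (ψ t)).2.1 hnbA] at h
    obtain ⟨k, ν, hν, hνS⟩ := (hφP 0).1.1.2
    refine ⟨k, Fin.cons nb ν, ?_, l₀, ⟨⟨hl₀, hl₀pol⟩, mem_iInter.2 fun l => ?_⟩, hgrad⟩
    · have h := (hφP 0).2.2.2.2 k ν (Or.inl hν)
      rwa [(hφP 0).1.1.1] at h
    · have hlS : ν l ∈ S := hνS.subset (mem_range_self l)
      have hlreg := (hφP 0).1.2 _ hlS
      obtain ⟨q, hq, hqg⟩ := DisjProg.MPDC.exists_branch_multiplier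
        (fun i => hJA i (hlreg.1 i)) hlreg.2 hxφ hηφ (fun t => (hφP t).2.1) fun t => by
          obtain ⟨k', ν', hν', hνS'⟩ := (hφP t).1.1.2
          obtain ⟨l', hl'⟩ := hνS'.symm.subset hlS
          have h := (hφP t).2.2.1.2.2
          rw [hν'] at h
          rw [← hl']
          exact h.2.2 l'
      exact ⟨l₀ - q, q, by rw [map_sub, hgrad, hqg, sub_self], hq, (sub_add_cancel _ _).symm⟩
  · -- If no point of a branch improves on `f x₀`, then `x₀` is a minimizer, hence B-stationary, for
    -- that branch. As there are finitely many branches, the acceptance estimate holds for all of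
    -- them simultaneously.
    have hall : ∀ᶠ t in atTop, ∀ ν : P.Branch, ν ∈ P.subregBranches J x₀ →
        (∀ z, P.Fall z ∈ P.Dbranch ν → P.f x₀ ≤ P.f z) →
        ∀ u v, fderiv ℝ P.Fall (x t) u + v ∈ DisjProg.tangentCone (P.Dbranch ν) (P.Fall x₀) →
          ⟪gradient P.f (x t), u⟫ = -(σ t * ‖u‖ ^ 2 + ‖v‖ ^ 2) → σ t * ‖u‖ ≤ η t :=
      eventually_all.2 fun ν => eventually_imp_distrib_left.2 fun hν =>
        eventually_imp_distrib_left.2 fun hmin =>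
          (DisjProg.bStationary_of_forall_le hfd hmin).eventually_mul_norm_le hFd hLip hν.2 hx
            hσ_pos hη_pos hrate₂
    filter_upwards [hgood, hall] with t ⟨hex, hchk, _⟩ h₁ hM hν
    by_contra! hmin
    obtain ⟨-, hfeas, hval, -⟩ := DisjProg.MPDC.optimality_of_basicOutput (hσ_pos t) hchk.2.1
    rw [DisjProg.MPDC.branch_epsCone_eq hex fun i => hJA i (hν.1 i)] at hfeas
    exact absurd (hrej t hchk hM) (not_lt.2 (h₁ _ hν hmin _ _ hfeas hval))
  · have hall : ∀ᶠ t in atTop, ∀ ν : P.Branch, ν ∈ P.subregBranches J x₀ →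
        (∀ z, P.Fall z ∈ P.Dbranch ν → P.f x₀ ≤ P.f z) →
        ∀ u, fderiv ℝ P.Fall (x t) u ∈ DisjProg.tangentCone (P.Dbranch ν) (P.Fall x₀) →
          ‖u‖ ≤ Real.sqrt n → -η t ≤ ⟪gradient P.f (x t), u⟫ :=
      eventually_all.2 fun ν => eventually_imp_distrib_left.2 fun hν =>
        eventually_imp_distrib_left.2 fun hmin =>
          (DisjProg.bStationary_of_forall_le hfd hmin).eventually_neg_le_inner hFd hLip hν.2 hx
            hσ_pos hη_pos hrate₂ _
    filter_upwards [hgood, hall] with t ⟨hex, hchk, _⟩ h₁ k ν l hver hν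
    by_contra! hmin
    have h := hchk.2.2
    rw [hver] at h
    refine absurd (fun u hu hbox => ?_) h.2.2
    rw [DisjProg.MPDC.branch_epsCone_eq hex fun i => hJA i (hν.1 i)] at hu
    exact h₁ _ hν hmin u hu (DisjProg.MPDC.norm_le_sqrt_of_box hbox)
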